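/- Let $\Omega\subset\mathbb{R}^2$ be a bounded simply connected Lipschitz domain, and let $\mathcal{G}_h$ be a finite conforming subdivision of $\overline\Omega$ into nondegenerate closed convex quadrilaterals (two different cells are disjoint, or meet exactly in a common vertex, or exactly in a common edge). Let $P_k(Q)$ denote the polynomials of total degree at most $k$ on a cell $Q$. A vertex is a boundary vertex if it lies on $\partial\Omega$; an edge is a boundary edge if it is contained in $\partial\Omega$, and an interior edge otherwise. For each edge $e$ fix a unit normal $\mathbf n_e$, and write $\fint_e$ for the mean value over $e$. For a piecewise polynomial function, "continuous" below means that the values computed from all cells that contain the vertex or edge in question agree, and "vanishes" means that the value computed from every such cell is zero. Define - $V^{\rm RQM}_{h0}$: all $v\in L^2(\Omega)$ with $v|_Q\in P_2(Q)$ for every $Q\in\mathcal{G}_h$, such that $v(a)$ is continuous at every vertex $a$ and vanishes at every boundary vertex, and $\int_e\partial_{\mathbf n_e}v\,\mathrm ds$ is continuous across every interior edge $e$ and vanishes on every boundary edge $e$; - $V^{\rm PS}_{h0}$: all $w\in L^2(\Omega)$ with $w|_Q\in P_1(Q)$ for every $Q\in\mathcal{G}_h$, such that $\fint_e w\,\mathrm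 ds$ is continuous across every interior edge $e$ and vanishes on every boundary edge $e$; - $\mathring{V}^{\rm PS}_{h0}$: all $w=(w_1,w_2)\in (V^{\rm PS}_{h0})^2$ with $\partial_1w_1+\partial_2w_2=0$ on every cell $Q\in\mathcal{G}_h$. Let $\mathrm{curl}_h v=(\partial_2v,-\partial_1v)$, computed cell by cell. Then $$\mathrm{curl}_h V^{\rm RQM}_{h0}=\mathring{V}^{\rm PS}_{h0}.$$ -/

import Mathlib

open MeasureTheory Set

noncomputable section

/-- The Euclidean plane. -/
abbrev Plane : Type := EuclideanSpace ℝ (Fin 2)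

/-- The space `L²(Ω)`. -/
abbrev L2 (Ω : Set Plane) : Type := Lp ℝ 2 (volume.restrict Ω)

/-- The planar cross product. -/
def cross (u v : Plane) : ℝ := u 0 * v 1 - u 1 * v 0

/-- Bounded Lipschitz domain: a bounded, connected open set which, near each boundary point and in
suitable orthonormal coordinates, is the part of the plane above the graph of a Lipschitz
function. -/
structure IsLipschitzDomain (Ω : Set Plane) : Prop where
  isOpen : IsOpen Ω
  isConnected : IsConnected Ω
  isBounded : Bornology.IsBounded Ω
  boundary : ∀ x ∈ frontier Ω, ∃ (T : Plane ≃ₗᵢ[ℝ] Plane) (K : NNReal) (f : ℝ → ℝ) (U : Set Plane),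
    LipschitzWith K f ∧ IsOpen U ∧ x ∈ U ∧ Ω ∩ U = {y | f (T y 0) < T y 1} ∩ U

/-- A nondegenerate convex quadrilateral, given by its vertices in counterclockwise order
(indices are cyclic): at every vertex the boundary turns strictly to the left. -/
structure ConvexQuad where
  vertex : Fin 4 → Plane
  ccw : ∀ k, 0 < cross (vertex (k + 1) - vertex k) (vertex (k + 2) - vertex (k + 1))

namespace ConvexQuad

/-- The closed region occupied by the quadrilateral. -/
def carrier (Q : ConvexQuad) : Set Plane := convexHull ℝ (range Q.vertex)

/-- `a` is a vertex of `Q`. -/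
def IsVertex (Q : ConvexQuad) (a : Plane) : Prop := ∃ k, Q.vertex k = a

/-- The segment with end points `a`, `b` (in either order) is an edge of `Q`. -/
def IsEdge (Q : ConvexQuad) (a b : Plane) : Prop :=
  ∃ k, (Q.vertex k = a ∧ Q.vertex (k + 1) = b) ∨ (Q.vertex k = b ∧ Q.vertex (k + 1) = a)

end ConvexQuad

/-- A subdivision of `Ω` into convex quadrilaterals: the closed cells cover the closure of `Ω`, and
two different cells are disjoint, or meet exactly in a common vertex, or exactly in a common
edge. -/
structure QuadMesh (Ω : Set Plane) (ι : Type*) where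
  cell : ι → ConvexQuad
  cover : ⋃ i, (cell i).carrier = closure Ω
  conforming : ∀ i j, i ≠ j →
    (cell i).carrier ∩ (cell j).carrier = ∅ ∨
    (∃ a, (cell i).IsVertex a ∧ (cell j).IsVertex a ∧
      (cell i).carrier ∩ (cell j).carrier = {a}) ∨
    (∃ a b, (cell i).IsEdge a b ∧ (cell j).IsEdge a b ∧
      (cell i).carrier ∩ (cell j).carrier = segment ℝ a b)

/-- Real polynomials in the two coordinates of the plane. -/
abbrev Poly2 : Type := MvPolynomial (Fin 2) ℝ

namespace Poly2

/-- The value of a polynomial at a point of the plane. -/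
def evalAt (p : Poly2) (x : Plane) : ℝ := MvPolynomial.eval (fun c => x c) p

/-- `curl p = (∂₂ p, -∂₁ p)`. -/
def curl (p : Poly2) : Fin 2 → Poly2 := ![MvPolynomial.pderiv 1 p, -MvPolynomial.pderiv 0 p]

/-- `div (p₁, p₂) = ∂₁ p₁ + ∂₂ p₂`. -/
def div (p : Fin 2 → Poly2) : Poly2 := MvPolynomial.pderiv 0 (p 0) + MvPolynomial.pderiv 1 (p 1)

/-- The derivative of `p` at `x` in the direction `n`. -/
def dirDeriv (p : Poly2) (n x : Plane) : ℝ :=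
  evalAt (MvPolynomial.pderiv 0 p) x * n 0 + evalAt (MvPolynomial.pderiv 1 p) x * n 1

end Poly2

/-- The mean value of a function over the segment from `a` to `b`. -/
def edgeMean (f : Plane → ℝ) (a b : Plane) : ℝ := ∫ t in (0 : ℝ)..1, f (AffineMap.lineMap a b t)

/-- The integral of a function over the segment from `a` to `b` with respect to arc length. -/
def edgeIntegral (f : Plane → ℝ) (a b : Plane) : ℝ := dist a b * edgeMean f a b

/-- The unit normal `n` to the segment from `a` to `b` for which `n × (b - a) > 0`. -/
def edgeNormal (a b : Plane) : Plane := (dist a b)⁻¹ • !₂[b 1 - a 1, -(b 0 - a 0)]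

namespace QuadMesh

variable {Ω : Set Plane} {ι : Type*}

/-- `a`, `b` are the end points of an edge of the mesh that lies on the boundary of `Ω`. -/
def IsBoundaryEdge (G : QuadMesh Ω ι) (a b : Plane) : Prop :=
  (∃ i, (G.cell i).IsEdge a b) ∧ segment ℝ a b ⊆ frontier Ω

/-- `a`, `b` are the end points of an edge of the mesh that does not lie on the boundary. -/
def IsInteriorEdge (G : QuadMesh Ω ι) (a b : Plane) : Prop :=
  (∃ i, (G.cell i).IsEdge a b) ∧ ¬ segment ℝ a b ⊆ frontier Ω

/-- On each cell the function `v` is given by the polynomial belonging to that cell. Since cells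
have interior points, the polynomials are determined by `v`; point values and edge integrals of `v`
taken from inside a cell are those of the polynomial. -/
def IsPiecewise (G : QuadMesh Ω ι) (v : L2 Ω) (p : ι → Poly2) : Prop :=
  ∀ i, ∀ᵐ x ∂(volume.restrict Ω), x ∈ (G.cell i).carrier → v x = (p i).evalAt x

/-- The reduced quadrilateral Morley space: piecewise quadratics, continuous at the vertices, with
the integral of the normal derivative continuous across interior edges. -/
def RQM (G : QuadMesh Ω ι) : Set (L2 Ω) :=
  {v | ∃ p : ι → Poly2, G.IsPiecewise v p ∧ (∀ i, (p i).totalDegree ≤ 2) ∧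
    (∀ a i j, (G.cell i).IsVertex a → (G.cell j).IsVertex a → (p i).evalAt a = (p j).evalAt a) ∧
    (∀ a b, G.IsInteriorEdge a b → ∀ i j, (G.cell i).IsEdge a b → (G.cell j).IsEdge a b →
      edgeIntegral ((p i).dirDeriv (edgeNormal a b)) a b =
        edgeIntegral ((p j).dirDeriv (edgeNormal a b)) a b)}

/-- The homogeneous reduced quadrilateral Morley space: moreover the values at boundary vertices
and the integrals of the normal derivative over boundary edges vanish. -/
def RQM0 (G : QuadMesh Ω ι) : Set (L2 Ω) :=
  {v | v ∈ G.RQM ∧ ∃ p : ι → Poly2, G.IsPiecewise v p ∧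
    (∀ a ∈ frontier Ω, ∀ i, (G.cell i).IsVertex a → (p i).evalAt a = 0) ∧
    (∀ a b, G.IsBoundaryEdge a b → ∀ i, (G.cell i).IsEdge a b →
      edgeIntegral ((p i).dirDeriv (edgeNormal a b)) a b = 0)}

/-- The Park–Sheen space: piecewise linear functions with edge means continuous across interior
edges. -/
def PS (G : QuadMesh Ω ι) : Set (L2 Ω) :=
  {w | ∃ p : ι → Poly2, G.IsPiecewise w p ∧ (∀ i, (p i).totalDegree ≤ 1) ∧
    (∀ a b, G.IsInteriorEdge a b → ∀ i j, (G.cell i).IsEdge a b → (G.cell j).IsEdge a b →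
      edgeMean (p i).evalAt a b = edgeMean (p j).evalAt a b)}

/-- The homogeneous Park–Sheen space: moreover the means over boundary edges vanish. -/
def PS0 (G : QuadMesh Ω ι) : Set (L2 Ω) :=
  {w | w ∈ G.PS ∧ ∃ p : ι → Poly2, G.IsPiecewise w p ∧
    (∀ a b, G.IsBoundaryEdge a b → ∀ i, (G.cell i).IsEdge a b → edgeMean (p i).evalAt a b = 0)}

/-- The vector field `w` is the cell by cell curl of the piecewise polynomial function `v`. -/
def IsCurl (G : QuadMesh Ω ι) (v : L2 Ω) (w : Fin 2 → L2 Ω) : Prop :=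
  ∃ p : ι → Poly2, G.IsPiecewise v p ∧ ∀ c, G.IsPiecewise (w c) (fun i => (p i).curl c)

/-- The piecewise polynomial vector field `w` has zero divergence on each cell. -/
def IsDivFree (G : QuadMesh Ω ι) (w : Fin 2 → L2 Ω) : Prop :=
  ∃ p : Fin 2 → ι → Poly2, (∀ c, G.IsPiecewise (w c) (p c)) ∧
    ∀ i, Poly2.div (fun c => p c i) = 0

/-- The piecewise divergence-free fields in the vector Park–Sheen space `(PS0)²`. -/
def divFreePS0 (G : QuadMesh Ω ι) : Set (Fin 2 → L2 Ω) :=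
  {w | (∀ c, w c ∈ G.PS0) ∧ G.IsDivFree w}

/-- The image of a set of piecewise polynomial functions under the cell by cell curl. -/
def curlImage (G : QuadMesh Ω ι) (V : Set (L2 Ω)) : Set (Fin 2 → L2 Ω) :=
  {w | ∃ v ∈ V, G.IsCurl v w}

end QuadMesh

end

/-! On an edge, the difference of the end point values of a polynomial is the edge length times the
tangential mean of its gradient, and the normal integral is the length times the normal mean. Since
the curl is the rotated gradient, matching edge means of the curl amounts to matching vertex
differences and normal integrals (`evalAt_sub_evalAt`, `edgeIntegral_dirDeriv`). This gives the
inclusion from left to right.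

Conversely, a divergence-free linear field on a cell is the curl of a quadratic, unique up to a
constant (`exists_curl_eq`). The constants must be chosen so that vertex values agree between cells
and vanish on the boundary; this is the topological core, `exists_vertex_potential`. On each cell
the vertex values are interpolated continuously, affinely along edges. Increments of these
interpolants agree on common edges and vanish along boundary edges, so together with the zero
function outside the domain they form local primitives on the whole plane. The plane is simply
connected, so they glue to one function. It is constant on the complement of the domain because that
complement is connected, the only use of simple connectedness of the domain. Subtracting that
constant gives the required shifts. -/

open Filter Topology

/-! ### Gluing local primitives by covering theory -/

/-- Local primitives whose differences are locally constant glue to a global function on a simply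
connected space. -/
theorem exists_glue_of_locally_constant_sub {X : Type*} [TopologicalSpace X]
    [SimplyConnectedSpace X] [LocallyPathConnectedSpace X] (U : X → Set X) (φ : X → X → ℝ)
    (hU : ∀ x, IsOpen (U x)) (hmem : ∀ x, x ∈ U x)
    (hφ : ∀ x y z, z ∈ U x → z ∈ U y → ∀ᶠ z' in nhds z, φ x z' - φ y z' = φ x z - φ y z) :
    ∃ f : X → ℝ, ∀ x, ∀ z ∈ U x, ∀ᶠ z' in nhds z, f z' - φ x z' = f z - φ x z := by
  -- With the discrete topology on the fibre, the bundle of primitives, whose transition maps are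
  -- translations by the differences of the `φ x`, is a covering.
  let _ : TopologicalSpace ℝ := ⊥
  have : DiscreteTopology ℝ := ⟨rfl⟩
  let Z : FiberBundleCore X X ℝ :=
    { baseSet := U
      isOpen_baseSet := hU
      indexAt := id
      mem_baseSet_at := hmem
      coordChange := fun x y z v => v + (φ x z - φ y z)
      coordChange_self := by intros; simp
      continuousOn_coordChange := by
        rintro x y ⟨z, v⟩ ⟨⟨hx, hy⟩, -⟩
        refine ContinuousAt.continuousWithinAt ?_
        rw [ContinuousAt, nhds_discrete ℝ, Filter.tendsto_pure, nhds_prod_eq, nhds_discrete ℝ]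
        refine ((hφ x y z hx hy).prod_mk (Filter.eventually_pure.2 (rfl : v = v) :
          ∀ᶠ v' in pure v, v' = v)).mono ?_
        rintro ⟨z', v'⟩ ⟨h1, h2⟩
        simp only at h1 h2 ⊢
        rw [h1, h2]
      coordChange_comp := by intros; ring }
  obtain ⟨x₀⟩ : Nonempty X := inferInstance
  have hcov : IsCoveringMap Z.proj := IsFiberBundle.isCoveringMap (F := ℝ)
    fun x => ⟨Z.localTriv x, hmem x⟩
  -- Lifting the identity yields a continuous global section.
  obtain ⟨s, ⟨-, hs⟩, -⟩ := hcov.existsUnique_continuousMap_lifts (ContinuousMap.id X) x₀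
    (⟨x₀, (0 : ℝ)⟩ : Z.TotalSpace) rfl
  have hs' : ∀ z, (s z).1 = z := fun z => congrFun hs z
  let σ : X → ℝ := fun z => (s z).2
  -- The fibre coordinate `σ z` is read in the chart indexed by `z` itself. In the chart of `x` it
  -- becomes `σ z + φ z z - φ x z`, which is continuous with discrete values, hence locally
  -- constant.
  refine ⟨fun z => σ z + φ z z, fun x z hz => ?_⟩
  have hval : ∀ z', ((Z.localTriv x) (s z')).2 = σ z' + (φ z' z' - φ x z') := by
    intro z'
    rw [Z.localTriv_apply]
    change σ z' + (φ (s z').1 (s z').1 - φ x (s z').1) = _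
    rw [hs' z']
  have hc : ContinuousAt (fun z' => ((Z.localTriv x) (s z')).2) z := by
    have h1 : ContinuousAt (Z.localTriv x) (s z) := by
      refine (Z.localTriv x).continuousAt ?_
      rw [Z.mem_localTriv_source, ← Z.baseSet_at]
      change (s z).1 ∈ U x
      rw [hs' z]; exact hz
    exact continuous_snd.continuousAt.comp (h1.comp s.continuous.continuousAt)
  rw [ContinuousAt, nhds_discrete ℝ, Filter.tendsto_pure] at hc
  refine hc.mono fun z' h => ?_
  rw [hval, hval] at h
  simp only
  linarith

/-! ### Connectedness of the complement of a simply connected domain -/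

theorem isPreconnected_setOf_lt_norm (R : ℝ) : IsPreconnected {x : Plane | R < ‖x‖} := by
  by_cases hR : R < 0
  · have : {x : Plane | R < ‖x‖} = univ :=
      eq_univ_of_forall fun x => lt_of_lt_of_le hR (norm_nonneg x)
    rw [this]; exact isPreconnected_univ
  have hR' : 0 ≤ R := not_lt.1 hR
  have hrank : 1 < Module.rank ℝ Plane := by
    rw [← Module.finrank_eq_rank]; simp
  -- Polar coordinates: the exterior is the image of a half-line times the unit circle.
  have h := ((isPreconnected_Ioi (a := R)).prod
    (isPreconnected_sphere hrank (0 : Plane) 1)).image (fun p : ℝ × Plane => p.1 • p.2)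
    (by fun_prop)
  convert h using 1
  ext x
  constructor
  · intro hx
    have hx' : R < ‖x‖ := hx
    have h0 : ‖x‖ ≠ 0 := by linarith
    refine ⟨(‖x‖, ‖x‖⁻¹ • x), ⟨hx', ?_⟩, ?_⟩
    · simp [norm_smul, h0]
    · simp [smul_smul, h0]
  · rintro ⟨⟨r, u⟩, ⟨hr, hu⟩, rfl⟩
    have hr' : R < r := hr
    have hu' : ‖u‖ = 1 := by simpa using hu
    simp only [mem_ofPred_eq, norm_smul, hu', Real.norm_eq_abs, mul_one]
    exact lt_of_lt_of_le hr' (le_abs_self r)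

/-- The coordinate of the complex plane. -/
noncomputable def toComplex (x : Plane) : ℂ := ⟨x 0, x 1⟩

/-- The inverse of `toComplex`. -/
noncomputable def ofComplex (z : ℂ) : Plane := !₂[z.re, z.im]

theorem continuous_toComplex : Continuous toComplex := by
  have : toComplex = fun x : Plane => ((x 0 : ℝ) : ℂ) + (x 1 : ℝ) * Complex.I := by
    funext x; apply Complex.ext <;> simp [toComplex]
  rw [this]; fun_prop

theorem continuous_ofComplex : Continuous ofComplex := by
  unfold ofComplex
  refine (PiLp.continuous_toLp 2 _).comp ?_
  refine continuous_pi fun i => ?_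
  fin_cases i
  · exact Complex.continuous_re
  · exact Complex.continuous_im

theorem toComplex_ofComplex (z : ℂ) : toComplex (ofComplex z) = z := by
  apply Complex.ext <;> simp [toComplex, ofComplex]

theorem ofComplex_toComplex (x : Plane) : ofComplex (toComplex x) = x := by
  ext i; fin_cases i <;> simp [toComplex, ofComplex]

theorem toComplex_injective : Function.Injective toComplex :=
  Function.LeftInverse.injective ofComplex_toComplex

theorem norm_ofComplex (z : ℂ) : ‖ofComplex z‖ = ‖z‖ := by
  rw [EuclideanSpace.norm_eq, Complex.norm_eq_sqrt_sq_add_sq]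
  simp [ofComplex, Fin.sum_univ_two]

/-- On a large circle there is no continuous branch of the logarithm. -/
theorem not_exists_log_outside {a : Plane} {R : ℝ} {k : Plane → ℂ} (hk : Continuous k)
    (h : ∀ x, R < ‖x‖ → Complex.exp (k x) = toComplex x - toComplex a) : False := by
  -- This radius puts the circle around `a` outside the ball of radius `R` about the origin.
  let r : ℝ := |R| + ‖toComplex a‖ + 1
  have hr : 0 < r := by positivity
  let γ : ℝ → Plane := fun θ => ofComplex (toComplex a + r * Complex.exp (θ * Complex.I))
  have hγ : Continuous γ := continuous_ofComplex.comp (by fun_prop)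
  have hγR : ∀ θ, R < ‖γ θ‖ := by
    intro θ
    have h1 : ‖(r : ℂ) * Complex.exp (θ * Complex.I)‖ = r := by
      rw [norm_mul, Complex.norm_exp_ofReal_mul_I, mul_one, Complex.norm_real, Real.norm_eq_abs,
        abs_of_pos hr]
    have h2 := norm_sub_le_norm_add ((r : ℂ) * Complex.exp (θ * Complex.I)) (toComplex a)
    rw [h1, add_comm] at h2
    simp only [γ]
    rw [norm_ofComplex]
    have := le_abs_self R
    simp only [r] at h2 ⊢
    linarith
  have hexp : ∀ θ, Complex.exp (k (γ θ)) = r * Complex.exp (θ * Complex.I) := by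
    intro θ
    rw [h _ (hγR θ)]
    simp only [γ]
    rw [toComplex_ofComplex]; ring
  -- Both sides lift the same curve through `exp` and agree at 0. After one turn the circle closes,
  -- but the right side has grown by `2πi`.
  have heq : (fun θ => k (γ θ)) = fun θ : ℝ => k (γ 0) + θ * Complex.I := by
    refine Complex.isCoveringMap_exp.eq_of_comp_eq (hk.comp hγ) (by fun_prop) ?_ 0 (by simp)
    funext θ
    apply Subtype.ext
    simp only [Function.comp]
    rw [Complex.exp_add, hexp, hexp]
    simp
  have h2 := congrFun heq (2 * Real.pi)
  have h3 : γ (2 * Real.pi) = γ 0 := by simp [γ]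
  simp only [h3] at h2
  have h4 : ((2 * Real.pi : ℝ) : ℂ) * Complex.I = 0 := by
    linear_combination -h2
  simp [Real.pi_ne_zero] at h4

/-- The complement of a simply connected open set has no bounded component. -/
theorem IsSimplyConnected.not_compl_eq_union {Ω A B : Set Plane} (hsc : IsSimplyConnected Ω)
    (hA : IsClosed A) (hB : IsClosed B) (hAB : Disjoint A B) (hΩ : Ωᶜ = A ∪ B)
    (hbd : Bornology.IsBounded Bᶜ) {a : Plane} (ha : a ∈ A) : False := by
  have hΩo : IsOpen Ω := by
    rw [← isClosed_compl_iff, hΩ]; exact hA.union hB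
  have haΩ : a ∉ Ω := fun h => (hΩ.symm ▸ Or.inl ha : a ∈ Ωᶜ) h
  -- A logarithm of `x - a` on `Ω`. It will be transplanted to a logarithm on the exterior of a
  -- large ball, which cannot exist.
  obtain ⟨g, hg, hge⟩ := Complex.exists_continuousOn_eqOn_exp_comp hsc hΩo
    (g := fun x => toComplex x - toComplex a)
    (continuous_toComplex.sub continuous_const).continuousOn (by
      rintro ⟨x, hx, h0⟩
      exact haΩ (toComplex_injective (sub_eq_zero.1 h0) ▸ hx))
  obtain ⟨W, hW, hAW, hWB⟩ := normal_exists_closure_subset hA hB.isOpen_compl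
    (subset_compl_iff_disjoint_right.2 hAB)
  have hfr : frontier W ⊆ Ω := by
    intro x hx
    by_contra hxΩ
    have : x ∈ A ∪ B := hΩ ▸ hxΩ
    rcases this with h | h
    · exact hx.2 (hW.interior_eq.symm ▸ hAW h)
    · exact hWB hx.1 h
  -- Tietze extension from the frontier of `W`, which lies in `Ω`.
  obtain ⟨g', hg'⟩ := ContinuousMap.exists_restrict_eq (Y := ℂ) (isClosed_frontier (s := W))
    ⟨(frontier W).domRestrict g, continuousOn_iff_continuous_domRestrict.1 (hg.mono hfr)⟩
  have hg'' : ∀ x ∈ frontier W, g' x = g x := fun x hx => congrArg (fun F => F ⟨x, hx⟩) hg'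
  classical
  -- Nowhere zero: an exponential on `W`, and `a` lies in `W`. So `h` has a logarithm on the plane,
  -- and far out `h` is `x - a`.
  let h : Plane → ℂ := W.piecewise (fun x => Complex.exp (g' x)) fun x => toComplex x - toComplex a
  have hcont : Continuous h := by
    refine Continuous.piecewise (fun x hx => ?_) (Complex.continuous_exp.comp g'.continuous)
      (continuous_toComplex.sub continuous_const)
    rw [hg'' x hx]
    exact hge (hfr hx)
  obtain ⟨k, hk, hke⟩ := Complex.exists_continuousOn_eqOn_exp_comp (U := (univ : Set Plane))
    (by
      have : ContractibleSpace (univ : Set Plane) :=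
        convex_univ.contractibleSpace ⟨0, trivial⟩
      exact (inferInstance : SimplyConnectedSpace (univ : Set Plane))) isOpen_univ
    hcont.continuousOn (by
      rintro ⟨x, -, h0⟩
      by_cases hx : x ∈ W
      · simp [h, hx, Complex.exp_ne_zero] at h0
      · simp only [h, hx, not_false_eq_true, piecewise_eq_of_notMem] at h0
        exact hx (toComplex_injective (sub_eq_zero.1 h0) ▸ hAW ha))
  obtain ⟨R, hR⟩ := hbd.subset_closedBall 0
  refine not_exists_log_outside (a := a) (R := R) (continuousOn_univ.1 hk) fun x hx => ?_
  have hxW : x ∉ W := by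
    intro hxW
    have := hR (hWB (subset_closure hxW))
    simp at this; linarith
  have := hke (mem_univ x)
  simpa [h, hxW] using this

/-- The complement of a bounded simply connected open subset of the plane is connected. -/
theorem IsSimplyConnected.isPreconnected_compl {Ω : Set Plane} (hsc : IsSimplyConnected Ω)
    (hΩ : IsOpen Ω) (hbd : Bornology.IsBounded Ω) : IsPreconnected Ωᶜ := by
  obtain ⟨R, hR⟩ := hbd.subset_closedBall 0
  have hext : {x : Plane | R < ‖x‖} ⊆ Ωᶜ := by
    intro x hx hxΩ
    have := hR hxΩ
    simp at this hx; linarith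
  rw [isPreconnected_iff_subset_of_fully_disjoint_closed hΩ.isClosed_compl]
  intro A B hA hB hsub hdisj
  -- A piece of the complement disjoint from the one containing the exterior must be empty.
  have key : ∀ A B : Set Plane, IsClosed A → IsClosed B → Ωᶜ ⊆ A ∪ B → Disjoint A B →
      {x : Plane | R < ‖x‖} ⊆ B → Ωᶜ ⊆ B := by
    intro A B hA hB hsub hdisj hRB x hx
    by_contra hxB
    have hxA : x ∈ A := (hsub hx).resolve_right hxB
    refine hsc.not_compl_eq_union (A := A ∩ Ωᶜ) (B := B ∩ Ωᶜ) (hA.inter hΩ.isClosed_compl)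
      (hB.inter hΩ.isClosed_compl) (hdisj.mono inter_subset_left inter_subset_left) ?_ ?_ ⟨hxA, hx⟩
    · rw [← union_inter_distrib_right]
      exact (inter_eq_right.2 hsub).symm
    · refine (Metric.isBounded_closedBall (x := (0 : Plane)) (r := R)).subset fun y hy => ?_
      by_contra hy'
      simp only [Metric.mem_closedBall, dist_zero_right, not_le] at hy'
      exact hy ⟨hRB hy', hext hy'⟩
  rcases (isPreconnected_iff_subset_of_disjoint_closed.1 (isPreconnected_setOf_lt_norm R)) A B hA hB
    (hext.trans hsub) (by rw [hdisj.inter_eq, inter_empty]) with h | h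
  · exact Or.inl (key B A hB hA (by rwa [union_comm]) hdisj.symm h)
  · exact Or.inr (key A B hA hB hsub hdisj h)

/-! ### Geometry of convex quadrilaterals -/

theorem cross_lineMap (u c a b : Plane) (t : ℝ) :
    cross u (AffineMap.lineMap a b t - c) = (1 - t) * cross u (a - c) + t * cross u (b - c) := by
  simp [cross, AffineMap.lineMap_apply]; ring

theorem continuous_cross_sub (u c : Plane) : Continuous fun x => cross u (x - c) := by
  unfold cross; fun_prop

/-- A step of `ε` times the left normal of `b - a` raises the cross product by `ε |b - a|²`. -/
theorem frequently_cross_pos {a b y : Plane} (hab : a ≠ b) (hy : cross (b - a) (y - a) = 0) :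
    ∃ᶠ z in 𝓝 y, 0 < cross (b - a) (z - a) := by
  let n : Plane := !₂[-(b 1 - a 1), b 0 - a 0]
  have hlim : Tendsto (fun ε : ℝ => y + ε • n) (𝓝[>] 0) (𝓝 y) := by
    have : Tendsto (fun ε : ℝ => y + ε • n) (𝓝 0) (𝓝 (y + (0 : ℝ) • n)) :=
      (by fun_prop : Continuous fun ε : ℝ => y + ε • n).tendsto 0
    simp only [zero_smul, add_zero] at this
    exact this.mono_left nhdsWithin_le_nhds
  refine hlim.frequently (Eventually.frequently ?_)
  filter_upwards [self_mem_nhdsWithin] with ε hε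
  have hε' : 0 < ε := hε
  have hpos : 0 < (b 0 - a 0) ^ 2 + (b 1 - a 1) ^ 2 := by
    by_contra h
    apply hab
    have h0 : b 0 - a 0 = 0 := by nlinarith [sq_nonneg (b 0 - a 0), sq_nonneg (b 1 - a 1)]
    have h1 : b 1 - a 1 = 0 := by nlinarith [sq_nonneg (b 0 - a 0), sq_nonneg (b 1 - a 1)]
    ext i; fin_cases i
    · simp; linarith
    · simp; linarith
  have : cross (b - a) (y + ε • n - a) = ε * ((b 0 - a 0) ^ 2 + (b 1 - a 1) ^ 2) := by
    simp only [cross, n, PiLp.sub_apply, PiLp.add_apply, PiLp.smul_apply, smul_eq_mul,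
      Matrix.cons_val_zero, Matrix.cons_val_one] at hy ⊢
    linear_combination hy
  rw [this]; positivity

namespace ConvexQuad

variable (Q : ConvexQuad)

/-- The position of `x` relative to the `k`-th edge: positive to the left of the edge. -/
noncomputable def side (k : Fin 4) (x : Plane) : ℝ :=
  cross (Q.vertex (k + 1) - Q.vertex k) (x - Q.vertex k)

theorem continuous_side (k : Fin 4) : Continuous (Q.side k) := continuous_cross_sub _ _

theorem side_lineMap (k : Fin 4) (a b : Plane) (t : ℝ) :
    Q.side k (AffineMap.lineMap a b t) = (1 - t) * Q.side k a + t * Q.side k b :=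
  cross_lineMap _ _ _ _ _

theorem side_sum (k : Fin 4) {w : Fin 4 → ℝ} (hw : ∑ j, w j = 1) :
    Q.side k (∑ j, w j • Q.vertex j) = ∑ j, w j * Q.side k (Q.vertex j) := by
  have h3 : w 3 = 1 - w 0 - w 1 - w 2 := by
    rw [Fin.sum_univ_four] at hw; linarith
  simp only [side, cross, Fin.sum_univ_four, PiLp.sub_apply, PiLp.add_apply, PiLp.smul_apply,
    smul_eq_mul, h3]
  ring

theorem side_vertex_self (k : Fin 4) : Q.side k (Q.vertex k) = 0 := by simp [side, cross]

theorem side_vertex_add_one (k : Fin 4) : Q.side k (Q.vertex (k + 1)) = 0 := by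
  simp only [side, cross]; ring

theorem side_vertex_add_two (k : Fin 4) : 0 < Q.side k (Q.vertex (k + 2)) := by
  have h := Q.ccw k
  simp only [side, cross, PiLp.sub_apply] at h ⊢
  linarith

theorem side_vertex_add_three (k : Fin 4) : 0 < Q.side k (Q.vertex (k + 3)) := by
  have h := Q.ccw (k + 3)
  rw [show k + 3 + 1 = k by omega, show k + 3 + 2 = k + 1 by omega] at h
  simp only [side, cross, PiLp.sub_apply] at h ⊢
  linarith

theorem eq_add_cases (k m : Fin 4) : m = k ∨ m = k + 1 ∨ m = k + 2 ∨ m = k + 3 := by omega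

theorem side_vertex_nonneg (k m : Fin 4) : 0 ≤ Q.side k (Q.vertex m) := by
  rcases eq_add_cases k m with rfl | rfl | rfl | rfl
  · exact (Q.side_vertex_self _).ge
  · exact (Q.side_vertex_add_one _).ge
  · exact (Q.side_vertex_add_two _).le
  · exact (Q.side_vertex_add_three _).le

theorem side_vertex_eq_zero {k m : Fin 4} (h : Q.side k (Q.vertex m) = 0) : m = k ∨ m = k + 1 := by
  rcases eq_add_cases k m with rfl | rfl | rfl | rfl
  · exact Or.inl rfl
  · exact Or.inr rfl
  · exact absurd h (Q.side_vertex_add_two _).ne'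
  · exact absurd h (Q.side_vertex_add_three _).ne'

theorem vertex_ne_vertex_add_one (k : Fin 4) : Q.vertex k ≠ Q.vertex (k + 1) := by
  intro h
  have := Q.ccw k
  simp [h, cross] at this

theorem mem_carrier_iff_exists {x : Plane} : x ∈ Q.carrier ↔
    ∃ w : Fin 4 → ℝ, (∀ j, 0 ≤ w j) ∧ ∑ j, w j = 1 ∧ ∑ j, w j • Q.vertex j = x := by
  rw [carrier, convexHull_range_eq_exists_affineCombination]
  constructor
  · rintro ⟨s, w, hw0, hw1, rfl⟩
    refine ⟨fun j => if j ∈ s then w j else 0, fun j => ?_, ?_, ?_⟩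
    · dsimp only; split_ifs with h
      · exact hw0 j h
      · exact le_rfl
    · simpa using hw1
    · rw [Finset.affineCombination_eq_linear_combination _ _ _ hw1]
      simp [ite_smul]
  · rintro ⟨w, hw0, hw1, rfl⟩
    refine ⟨Finset.univ, w, fun j _ => hw0 j, hw1, ?_⟩
    rw [Finset.affineCombination_eq_linear_combination _ _ _ hw1]

theorem isCompact_carrier : IsCompact Q.carrier := (finite_range _).isCompact_convexHull ℝ

theorem isClosed_carrier : IsClosed Q.carrier := Q.isCompact_carrier.isClosed

theorem convex_carrier : Convex ℝ Q.carrier := convex_convexHull ℝ _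

theorem vertex_mem_carrier (k : Fin 4) : Q.vertex k ∈ Q.carrier :=
  subset_convexHull ℝ _ (mem_range_self k)

theorem segment_subset_carrier (k : Fin 4) :
    segment ℝ (Q.vertex k) (Q.vertex (k + 1)) ⊆ Q.carrier :=
  Q.convex_carrier.segment_subset (Q.vertex_mem_carrier _) (Q.vertex_mem_carrier _)

theorem mem_carrier_iff {x : Plane} : x ∈ Q.carrier ↔ ∀ k, 0 ≤ Q.side k x := by
  rw [mem_carrier_iff_exists]
  constructor
  · rintro ⟨w, hw0, hw1, rfl⟩ k
    rw [Q.side_sum k hw1]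
    exact Finset.sum_nonneg fun j _ => mul_nonneg (hw0 j) (Q.side_vertex_nonneg k j)
  · intro h
    have h0 := h 0
    have h1 := h 1
    have h2 := h 2
    have h3 := h 3
    have hT := Q.ccw 0
    have hT' := Q.ccw 2
    simp only [side, Fin.isValue, zero_add, show (1 : Fin 4) + 1 = 2 from rfl,
      show (2 : Fin 4) + 1 = 3 from rfl, show (3 : Fin 4) + 1 = 0 from rfl,
      show (2 : Fin 4) + 2 = 0 from rfl] at h0 h1 h2 h3 hT hT'
    -- The diagonal from vertex 0 to vertex 2 cuts the cell into two triangles; the weights are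
    -- barycentric coordinates in the one on the side of `x`.
    rcases le_total (cross (Q.vertex 2 - Q.vertex 0) (x - Q.vertex 0)) 0 with hD | hD
    · set T := cross (Q.vertex 1 - Q.vertex 0) (Q.vertex 2 - Q.vertex 1) with hTdef
      refine ⟨![cross (Q.vertex 2 - Q.vertex 1) (x - Q.vertex 1) / T,
        -cross (Q.vertex 2 - Q.vertex 0) (x - Q.vertex 0) / T,
        cross (Q.vertex 1 - Q.vertex 0) (x - Q.vertex 0) / T, 0], ?_, ?_, ?_⟩
      · intro j
        fin_cases j
        · exact div_nonneg h1 hT.le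
        · exact div_nonneg (neg_nonneg.2 hD) hT.le
        · exact div_nonneg h0 hT.le
        · exact le_rfl
      · simp only [Fin.sum_univ_four, Matrix.cons_val]
        field_simp
        simp only [hTdef, cross, PiLp.sub_apply]; ring
      · ext i
        simp only [Fin.sum_univ_four, Matrix.cons_val, PiLp.add_apply, PiLp.smul_apply, smul_eq_mul]
        field_simp
        simp only [hTdef, cross, PiLp.sub_apply]
        fin_cases i
        · simp only [Fin.zero_eta]; ring
        · simp only [Fin.mk_one]; ring
    · set T := cross (Q.vertex 3 - Q.vertex 2) (Q.vertex 0 - Q.vertex 3) with hTdef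
      refine ⟨![cross (Q.vertex 3 - Q.vertex 2) (x - Q.vertex 2) / T, 0,
        cross (Q.vertex 0 - Q.vertex 3) (x - Q.vertex 3) / T,
        cross (Q.vertex 2 - Q.vertex 0) (x - Q.vertex 0) / T], ?_, ?_, ?_⟩
      · intro j
        fin_cases j
        · exact div_nonneg h2 hT'.le
        · exact le_rfl
        · exact div_nonneg h3 hT'.le
        · exact div_nonneg hD hT'.le
      · simp only [Fin.sum_univ_four, Matrix.cons_val]
        field_simp
        simp only [hTdef, cross, PiLp.sub_apply]; ring
      · ext i
        simp only [Fin.sum_univ_four, Matrix.cons_val, PiLp.add_apply, PiLp.smul_apply, smul_eq_mul]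
        field_simp
        simp only [hTdef, cross, PiLp.sub_apply]
        fin_cases i
        · simp only [Fin.zero_eta]; ring
        · simp only [Fin.mk_one]; ring

theorem setOf_side_pos_subset_interior : {x | ∀ k, 0 < Q.side k x} ⊆ interior Q.carrier := by
  refine interior_maximal (fun x hx => Q.mem_carrier_iff.2 fun k => (hx k).le) ?_
  have : {x | ∀ k, 0 < Q.side k x} = ⋂ k, {x | 0 < Q.side k x} := by ext x; simp
  rw [this]
  exact isOpen_iInter_of_finite fun k => isOpen_lt continuous_const (Q.continuous_side k)

theorem interior_carrier_nonempty : (interior Q.carrier).Nonempty := by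
  refine ⟨∑ j, (1 / 4 : ℝ) • Q.vertex j, Q.setOf_side_pos_subset_interior fun k => ?_⟩
  rw [Q.side_sum k (w := fun _ => 1 / 4) (by norm_num)]
  refine Finset.sum_pos' (fun j _ => mul_nonneg (by norm_num) (Q.side_vertex_nonneg k j))
    ⟨k + 2, Finset.mem_univ _, mul_pos (by norm_num) (Q.side_vertex_add_two k)⟩

theorem side_eq_zero_of_mem_segment {k : Fin 4} {x : Plane}
    (hx : x ∈ segment ℝ (Q.vertex k) (Q.vertex (k + 1))) : Q.side k x = 0 := by
  rw [segment_eq_image_lineMap] at hx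
  obtain ⟨t, -, rfl⟩ := hx
  rw [side_lineMap, side_vertex_self, side_vertex_add_one]; ring

theorem mem_segment_of_side_eq_zero {k : Fin 4} {x : Plane} (hx : x ∈ Q.carrier)
    (h : Q.side k x = 0) : x ∈ segment ℝ (Q.vertex k) (Q.vertex (k + 1)) := by
  obtain ⟨w, hw0, hw1, rfl⟩ := Q.mem_carrier_iff_exists.1 hx
  rw [Q.side_sum k hw1, Finset.sum_eq_zero_iff_of_nonneg
    fun j _ => mul_nonneg (hw0 j) (Q.side_vertex_nonneg k j)] at h
  have hw : ∀ j, j ≠ k → j ≠ k + 1 → w j = 0 := by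
    intro j hjk hjk'
    rcases mul_eq_zero.1 (h j (Finset.mem_univ j)) with h' | h'
    · exact h'
    · rcases Q.side_vertex_eq_zero h' with h'' | h''
      · exact absurd h'' hjk
      · exact absurd h'' hjk'
  have hk : k ≠ k + 1 := by omega
  refine ⟨w k, w (k + 1), hw0 _, hw0 _, ?_, ?_⟩
  · rw [← hw1, Fintype.sum_eq_add k (k + 1) hk]
    rintro j ⟨h1, h2⟩; exact hw j h1 h2
  · rw [Fintype.sum_eq_add k (k + 1) hk]
    rintro j ⟨h1, h2⟩; rw [hw j h1 h2, zero_smul]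

theorem side_pos_of_mem_segment {k m : Fin 4} (hm : m ≠ k) {x : Plane}
    (hx : x ∈ segment ℝ (Q.vertex k) (Q.vertex (k + 1))) (h0 : x ≠ Q.vertex k)
    (h1 : x ≠ Q.vertex (k + 1)) : 0 < Q.side m x := by
  rw [segment_eq_image_lineMap] at hx
  obtain ⟨t, ⟨ht0, ht1⟩, rfl⟩ := hx
  have ht0' : 0 < t := lt_of_le_of_ne ht0 fun h => h0 (by simp [← h])
  have ht1' : 0 < 1 - t := sub_pos.2 (lt_of_le_of_ne ht1 fun h => h1 (by simp [h]))
  rw [side_lineMap]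
  have n0 := Q.side_vertex_nonneg m k
  have n1 := Q.side_vertex_nonneg m (k + 1)
  by_cases hz : Q.side m (Q.vertex k) = 0
  · have hz' : Q.side m (Q.vertex (k + 1)) ≠ 0 := by
      intro hz'
      have a1 := Q.side_vertex_eq_zero hz
      have a2 := Q.side_vertex_eq_zero hz'
      omega
    have := lt_of_le_of_ne n1 hz'.symm
    positivity
  · have := lt_of_le_of_ne n0 (Ne.symm hz)
    positivity

/-- At an inner point of an edge the other three side functions are positive, so nearby only the
`k`-th one decides membership. -/
theorem eventually_mem_carrier {k : Fin 4} {x : Plane}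
    (hx : x ∈ segment ℝ (Q.vertex k) (Q.vertex (k + 1))) (h0 : x ≠ Q.vertex k)
    (h1 : x ≠ Q.vertex (k + 1)) : ∀ᶠ z in 𝓝 x, 0 ≤ Q.side k z → z ∈ Q.carrier := by
  have : ∀ᶠ z in 𝓝 x, ∀ m, m ≠ k → 0 < Q.side m z := by
    rw [eventually_all]
    intro m
    by_cases hm : m = k
    · simp [hm]
    · filter_upwards [((Q.continuous_side m).tendsto x).eventually_const_lt
        (Q.side_pos_of_mem_segment hm hx h0 h1)] with z hz _ using hz
  filter_upwards [this] with z hz hk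
  refine Q.mem_carrier_iff.2 fun m => ?_
  by_cases hm : m = k
  · rwa [hm]
  · exact (hz m hm).le

theorem eq_of_vertex_mem_segment {k m : Fin 4}
    (h : Q.vertex m ∈ segment ℝ (Q.vertex k) (Q.vertex (k + 1))) : m = k ∨ m = k + 1 :=
  Q.side_vertex_eq_zero (Q.side_eq_zero_of_mem_segment h)

theorem exists_mem_segment_of_notMem_interior {x : Plane} (hx : x ∈ Q.carrier)
    (h : x ∉ interior Q.carrier) : ∃ k, x ∈ segment ℝ (Q.vertex k) (Q.vertex (k + 1)) := by
  by_contra! hk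
  exact h (Q.setOf_side_pos_subset_interior fun k =>
    lt_of_le_of_ne (Q.mem_carrier_iff.1 hx k) fun h0 =>
      hk k (Q.mem_segment_of_side_eq_zero hx h0.symm))

variable {Q} {Q' : ConvexQuad}

/-- Two quadrilaterals that meet only in a common edge cannot induce the same orientation on it. -/
theorem not_same_orientation {k m : Fin 4} (h0 : Q.vertex k = Q'.vertex m)
    (h1 : Q.vertex (k + 1) = Q'.vertex (m + 1))
    (hint : Q.carrier ∩ Q'.carrier ⊆ segment ℝ (Q.vertex k) (Q.vertex (k + 1))) : False := by
  have hne := Q.vertex_ne_vertex_add_one k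
  let y := AffineMap.lineMap (Q.vertex k) (Q.vertex (k + 1)) (1 / 2 : ℝ)
  have hy : y ∈ segment ℝ (Q.vertex k) (Q.vertex (k + 1)) := by
    rw [segment_eq_image_lineMap]; exact ⟨1 / 2, by norm_num, rfl⟩
  have hy0 : y ≠ Q.vertex k := by
    simp only [y, ne_eq, AffineMap.lineMap_eq_left_iff]; simp [hne]
  have hy1 : y ≠ Q.vertex (k + 1) := by
    simp only [y, ne_eq, AffineMap.lineMap_eq_right_iff]; norm_num [hne]
  have e1 := Q.eventually_mem_carrier hy hy0 hy1
  have e2 := Q'.eventually_mem_carrier (h1 ▸ h0 ▸ hy) (h0 ▸ hy0) (h1 ▸ hy1)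
  -- Both cells would lie to the left of the edge, so a point just left of its midpoint would belong
  -- to both.
  have hf := frequently_cross_pos hne (Q.side_eq_zero_of_mem_segment hy)
  obtain ⟨z, hz, hz1, hz2⟩ := (hf.and_eventually (e1.and e2)).exists
  have hside : Q'.side m z = Q.side k z := by simp only [side, h0, h1]
  have := Q.side_eq_zero_of_mem_segment (hint ⟨hz1 hz.le, hz2 (hside ▸ hz.le)⟩)
  exact hz.ne' this

theorem union_mem_nhds_of_opposite_orientation {k m : Fin 4} (h0 : Q.vertex k = Q'.vertex (m + 1))
    (h1 : Q.vertex (k + 1) = Q'.vertex m) {y : Plane}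
    (hy : y ∈ segment ℝ (Q.vertex k) (Q.vertex (k + 1))) (hy0 : y ≠ Q.vertex k)
    (hy1 : y ≠ Q.vertex (k + 1)) : Q.carrier ∪ Q'.carrier ∈ 𝓝 y := by
  have e1 := Q.eventually_mem_carrier hy hy0 hy1
  have e2 := Q'.eventually_mem_carrier (x := y) (k := m)
    (by rw [← h0, ← h1, segment_symm]; exact hy) (h1 ▸ hy1) (h0 ▸ hy0)
  filter_upwards [e1, e2] with z hz1 hz2
  rcases le_total 0 (Q.side k z) with h | h
  · exact Or.inl (hz1 h)
  · refine Or.inr (hz2 ?_)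
    have : Q'.side m z = -Q.side k z := by
      simp only [side, ← h0, ← h1, cross, PiLp.sub_apply]; ring
    linarith

/-- Two quadrilaterals that meet exactly in a common edge cover a neighbourhood of each point of
the open edge. -/
theorem union_mem_nhds_of_inter_eq {a b : Plane} (hQ : Q.IsEdge a b) (hQ' : Q'.IsEdge a b)
    (hint : Q.carrier ∩ Q'.carrier = segment ℝ a b) {y : Plane} (hy : y ∈ segment ℝ a b)
    (hya : y ≠ a) (hyb : y ≠ b) : Q.carrier ∪ Q'.carrier ∈ 𝓝 y := by
  obtain ⟨k, ⟨rfl, rfl⟩ | ⟨rfl, rfl⟩⟩ := hQ <;> obtain ⟨m, ⟨h0, h1⟩ | ⟨h0, h1⟩⟩ := hQ'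
  · exact (not_same_orientation h0.symm h1.symm hint.subset).elim
  · exact union_mem_nhds_of_opposite_orientation h1.symm h0.symm hy hya hyb
  · rw [segment_symm] at hy
    exact union_mem_nhds_of_opposite_orientation h1.symm h0.symm hy hyb hya
  · rw [segment_symm] at hint
    exact (not_same_orientation h0.symm h1.symm hint.subset).elim

/-- A continuous function with prescribed vertex values that is affine on each edge. -/
theorem exists_interpolant (Q : ConvexQuad) (c : Fin 4 → ℝ) : ∃ g : Plane → ℝ, Continuous g ∧
    ∀ k, ∀ t ∈ Icc (0 : ℝ) 1, g (AffineMap.lineMap (Q.vertex k) (Q.vertex (k + 1)) t) =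
      (1 - t) * c k + t * c (k + 1) := by
  let D : Plane → ℝ := fun x => cross (Q.vertex 2 - Q.vertex 0) (x - Q.vertex 0)
  let T := cross (Q.vertex 1 - Q.vertex 0) (Q.vertex 2 - Q.vertex 1)
  have hT : 0 < T := Q.ccw 0
  -- The affine function with the prescribed values at vertices 0, 1, 2, written in barycentric
  -- coordinates.
  let L : Plane → ℝ := fun x => (c 0 * Q.side 1 x + c 2 * Q.side 0 x - c 1 * D x) / T
  have hDl : ∀ a b t, D (AffineMap.lineMap a b t) = (1 - t) * D a + t * D b :=
    fun a b t => cross_lineMap _ _ _ _ _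
  have hLl : ∀ a b t, L (AffineMap.lineMap a b t) = (1 - t) * L a + t * L b := by
    intro a b t
    simp only [L, hDl, side_lineMap]; ring
  have hD0 : D (Q.vertex 0) = 0 := by simp [D, cross]
  have hD2 : D (Q.vertex 2) = 0 := by simp only [D, cross]; ring
  have hD1 : D (Q.vertex 1) = -T := by simp only [D, T, cross, PiLp.sub_apply]; ring
  have hD3 : 0 < D (Q.vertex 3) := by
    have h := Q.ccw 2
    have : D (Q.vertex 3) = cross (Q.vertex 3 - Q.vertex 2) (Q.vertex 0 - Q.vertex 3) := by
      simp only [D, cross, PiLp.sub_apply]; ring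
    rw [this]; exact h
  have hL0 : L (Q.vertex 0) = c 0 := by
    have h1 : Q.side 1 (Q.vertex 0) = T := by
      simp only [side, T, cross, PiLp.sub_apply, show (1 : Fin 4) + 1 = 2 from rfl]; ring
    simp only [L, hD0, h1, side_vertex_self]; field_simp; ring
  have hL1 : L (Q.vertex 1) = c 1 := by
    have h1 : Q.side 0 (Q.vertex 1) = 0 := Q.side_vertex_add_one 0
    simp only [L, hD1, h1, side_vertex_self]; field_simp; ring
  have hL2 : L (Q.vertex 2) = c 2 := by
    have h1 : Q.side 1 (Q.vertex 2) = 0 := Q.side_vertex_add_one 1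
    have h2 : Q.side 0 (Q.vertex 2) = T := by
      simp only [side, T, cross, PiLp.sub_apply, zero_add]; ring
    simp only [L, hD2, h1, h2]; field_simp; ring
  -- One affine function cannot match four values, so the interpolant is bent along the diagonal:
  -- `max 0 D` vanishes on the side of vertex 1 and corrects the value at vertex 3.
  let β := (c 3 - L (Q.vertex 3)) / D (Q.vertex 3)
  have hβ : β * D (Q.vertex 3) = c 3 - L (Q.vertex 3) := div_mul_cancel₀ _ hD3.ne'
  refine ⟨fun x => L x + β * max 0 (D x), ?_, ?_⟩
  · have h1 := Q.continuous_side 0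
    have h2 := Q.continuous_side 1
    have h3 : Continuous D := continuous_cross_sub _ _
    fun_prop
  · intro k t ht
    obtain ⟨ht0, ht1⟩ := ht
    have ht1' : 0 ≤ 1 - t := by linarith
    fin_cases k
    · change L (AffineMap.lineMap (Q.vertex 0) (Q.vertex 1) t) +
        β * max 0 (D (AffineMap.lineMap (Q.vertex 0) (Q.vertex 1) t)) = (1 - t) * c 0 + t * c 1
      rw [hLl, hDl, hD0, hD1, hL0, hL1, max_eq_left (by nlinarith)]; ring
    · change L (AffineMap.lineMap (Q.vertex 1) (Q.vertex 2) t) +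
        β * max 0 (D (AffineMap.lineMap (Q.vertex 1) (Q.vertex 2) t)) = (1 - t) * c 1 + t * c 2
      rw [hLl, hDl, hD1, hD2, hL1, hL2, max_eq_left (by nlinarith)]; ring
    · change L (AffineMap.lineMap (Q.vertex 2) (Q.vertex 3) t) +
        β * max 0 (D (AffineMap.lineMap (Q.vertex 2) (Q.vertex 3) t)) = (1 - t) * c 2 + t * c 3
      rw [hLl, hDl, hD2, hL2, max_eq_right (by nlinarith)]
      linear_combination t * hβ
    · change L (AffineMap.lineMap (Q.vertex 3) (Q.vertex 0) t) +
        β * max 0 (D (AffineMap.lineMap (Q.vertex 3) (Q.vertex 0) t)) = (1 - t) * c 3 + t * c 0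
      rw [hLl, hDl, hD0, hL0, max_eq_right (by nlinarith)]
      linear_combination (1 - t) * hβ

end ConvexQuad

/-! ### Polynomials, edge means and stream functions -/

namespace Poly2

open MvPolynomial

theorem continuous_evalAt (p : Poly2) : Continuous p.evalAt := by
  unfold evalAt
  exact (MvPolynomial.continuous_eval p).comp (by fun_prop)

theorem evalAt_neg (p : Poly2) (x : Plane) : evalAt (-p) x = -evalAt p x := by
  simp [evalAt]

theorem hasDerivAt_evalAt_lineMap (p : Poly2) (a b : Plane) (t : ℝ) :
    HasDerivAt (fun t : ℝ => evalAt p (AffineMap.lineMap a b t))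
      ((b 0 - a 0) * evalAt (pderiv 0 p) (AffineMap.lineMap a b t) +
        (b 1 - a 1) * evalAt (pderiv 1 p) (AffineMap.lineMap a b t)) t := by
  induction p using MvPolynomial.induction_on with
  | C r => simpa [evalAt] using hasDerivAt_const t r
  | add p q hp hq =>
    convert! hp.add hq using 1
    · funext s; simp [evalAt]
    · simp [evalAt]; ring
  | mul_X p i hp =>
    have hX : HasDerivAt (fun t : ℝ => (AffineMap.lineMap a b t : Plane) i) (b i - a i) t := by
      have h := ((hasDerivAt_id t).mul_const (b i - a i)).add_const (a i)
      simp only [id, one_mul] at h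
      convert! h using 1
    convert! hp.mul hX using 1
    · funext s; simp [evalAt]
    · fin_cases i <;> simp [evalAt, pderiv_X] <;> ring

theorem intervalIntegrable_evalAt_lineMap (p : Poly2) (a b : Plane) :
    IntervalIntegrable (fun t : ℝ => evalAt p (AffineMap.lineMap a b t)) volume 0 1 :=
  ((continuous_evalAt p).comp AffineMap.lineMap_continuous).intervalIntegrable _ _

/-- The fundamental theorem of calculus along the edge: vertex values see the tangential part of the
mean gradient. -/
theorem evalAt_sub_evalAt (p : Poly2) (a b : Plane) :
    evalAt p b - evalAt p a = (b 0 - a 0) * edgeMean (evalAt (pderiv 0 p)) a b +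
      (b 1 - a 1) * edgeMean (evalAt (pderiv 1 p)) a b := by
  have h0 := (intervalIntegrable_evalAt_lineMap (pderiv 0 p) a b).const_mul (b 0 - a 0)
  have h1 := (intervalIntegrable_evalAt_lineMap (pderiv 1 p) a b).const_mul (b 1 - a 1)
  have h := intervalIntegral.integral_eq_sub_of_hasDerivAt
    (fun t _ => hasDerivAt_evalAt_lineMap p a b t) (h0.add h1)
  rw [intervalIntegral.integral_add h0 h1, intervalIntegral.integral_const_mul,
    intervalIntegral.integral_const_mul] at h
  simp only [AffineMap.lineMap_apply_zero, AffineMap.lineMap_apply_one] at h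
  exact h.symm

theorem edgeIntegral_dirDeriv (p : Poly2) (a b : Plane) :
    edgeIntegral (p.dirDeriv (edgeNormal a b)) a b =
      (b 1 - a 1) * edgeMean (evalAt (pderiv 0 p)) a b -
        (b 0 - a 0) * edgeMean (evalAt (pderiv 1 p)) a b := by
  rcases eq_or_ne a b with rfl | hab
  · simp [edgeIntegral]
  have hd : dist a b ≠ 0 := dist_ne_zero.2 hab
  have h0 := (intervalIntegrable_evalAt_lineMap (pderiv 0 p) a b).mul_const (edgeNormal a b 0)
  have h1 := (intervalIntegrable_evalAt_lineMap (pderiv 1 p) a b).mul_const (edgeNormal a b 1)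
  unfold edgeIntegral
  have h : edgeMean (p.dirDeriv (edgeNormal a b)) a b =
      edgeMean (evalAt (pderiv 0 p)) a b * edgeNormal a b 0 +
        edgeMean (evalAt (pderiv 1 p)) a b * edgeNormal a b 1 := by
    unfold edgeMean
    rw [← intervalIntegral.integral_mul_const, ← intervalIntegral.integral_mul_const,
      ← intervalIntegral.integral_add h0 h1]
    rfl
  rw [h]
  simp only [edgeNormal, PiLp.smul_apply, smul_eq_mul, Matrix.cons_val_zero, Matrix.cons_val_one]
  field_simp
  ring

theorem edgeMean_neg (p : Poly2) (a b : Plane) :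
    edgeMean (evalAt (-p)) a b = -edgeMean (evalAt p) a b := by
  simp only [edgeMean, evalAt_neg, intervalIntegral.integral_neg]

/-- The difference of the end point values and the normal integral determine the edge means of the
gradient. -/
theorem edgeMean_pderiv_eq {p q : Poly2} {a b : Plane} (hab : a ≠ b)
    (hv : evalAt p b - evalAt p a = evalAt q b - evalAt q a)
    (hn : edgeIntegral (p.dirDeriv (edgeNormal a b)) a b =
      edgeIntegral (q.dirDeriv (edgeNormal a b)) a b) (c : Fin 2) :
    edgeMean (evalAt (pderiv c p)) a b = edgeMean (evalAt (pderiv c q)) a b := by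
  rw [evalAt_sub_evalAt, evalAt_sub_evalAt] at hv
  rw [edgeIntegral_dirDeriv, edgeIntegral_dirDeriv] at hn
  -- The tangential and normal equations form a linear system of determinant `|b - a|²` up to sign.
  have hpos : (b 0 - a 0) ^ 2 + (b 1 - a 1) ^ 2 ≠ 0 := by
    intro h
    apply hab
    have h0 : b 0 - a 0 = 0 := by nlinarith [sq_nonneg (b 0 - a 0), sq_nonneg (b 1 - a 1)]
    have h1 : b 1 - a 1 = 0 := by nlinarith [sq_nonneg (b 0 - a 0), sq_nonneg (b 1 - a 1)]
    ext i; fin_cases i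
    · simp; linarith
    · simp; linarith
  refine mul_left_cancel₀ hpos ?_
  fin_cases c
  · simp only [Fin.zero_eta]
    linear_combination (b 0 - a 0) * hv + (b 1 - a 1) * hn
  · simp only [Fin.mk_one]
    linear_combination (b 1 - a 1) * hv - (b 0 - a 0) * hn

theorem totalDegree_pderiv_le {p : Poly2} {n : ℕ} (hp : p.totalDegree ≤ n + 1) (i : Fin 2) :
    (pderiv i p).totalDegree ≤ n := by
  refine Finset.sup_le fun m hm => ?_
  rw [mem_support_iff, coeff_pderiv] at hm
  have h := (le_totalDegree (mem_support_iff.2 (left_ne_zero_of_mul hm))).trans hp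
  rw [Finsupp.sum_add_index' (by simp) (by simp), Finsupp.sum_single_index rfl] at h
  omega

theorem totalDegree_curl_le {p : Poly2} {n : ℕ} (hp : p.totalDegree ≤ n + 1) (c : Fin 2) :
    (p.curl c).totalDegree ≤ n := by
  fin_cases c
  · exact totalDegree_pderiv_le hp 1
  · change (-pderiv 0 p).totalDegree ≤ n
    rw [totalDegree_neg]
    exact totalDegree_pderiv_le hp 0

/-- The commutator of two derivations is a derivation, and here it kills both variables. -/
theorem div_curl (p : Poly2) : div p.curl = 0 := by
  have h : pderiv 0 (pderiv 1 p) = pderiv 1 (pderiv 0 p) := by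
    have := Derivation.congr_fun (D1 := ⁅pderiv (R := ℝ) (0 : Fin 2), pderiv 1⁆) (D2 := 0)
      (MvPolynomial.derivation_ext fun i => by
        fin_cases i <;> simp [Derivation.commutator_apply, pderiv_X]) p
    rw [Derivation.commutator_apply] at this
    simpa [sub_eq_zero] using this
  simp [div, curl, h]

theorem eq_affine_of_totalDegree_le_one {p : Poly2} (hp : p.totalDegree ≤ 1) :
    ∃ r s t : ℝ, p = C r + C s * X 0 + C t * X 1 := by
  refine ⟨p.coeff 0, p.coeff (Finsupp.single 0 1), p.coeff (Finsupp.single 1 1), ?_⟩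
  have hs : ∀ m ∈ p.support, m = 0 ∨ m = Finsupp.single 0 1 ∨ m = Finsupp.single 1 1 := by
    intro m hm
    have h := (le_totalDegree hm).trans hp
    rw [Finsupp.sum_fintype _ _ (by simp), Fin.sum_univ_two] at h
    have : (m 0 = 0 ∧ m 1 = 0) ∨ (m 0 = 1 ∧ m 1 = 0) ∨ (m 0 = 0 ∧ m 1 = 1) := by omega
    rcases this with ⟨h0, h1⟩ | ⟨h0, h1⟩ | ⟨h0, h1⟩
    · left; ext i; fin_cases i <;> simp [h0, h1]
    · right; left; ext i; fin_cases i <;> simp [h0, h1]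
    · right; right; ext i; fin_cases i <;> simp [h0, h1]
  have n1 : (Finsupp.single 0 1 : Fin 2 →₀ ℕ) ≠ 0 := by simp
  have n2 : (Finsupp.single 1 1 : Fin 2 →₀ ℕ) ≠ 0 := by simp
  have n3 : (Finsupp.single 0 1 : Fin 2 →₀ ℕ) ≠ Finsupp.single 1 1 := by
    intro h; simpa using congrArg (fun f => f 0) h
  ext m
  simp only [coeff_add, coeff_C_mul, coeff_C, coeff_X]
  by_cases hm : m ∈ p.support
  · rcases hs m hm with rfl | rfl | rfl
    · simp [n1, n2]
    · simp [n1.symm, n3.symm]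
    · simp [n2.symm, n3]
  · have h0 := notMem_support_iff.1 hm
    rw [h0]
    by_cases e0 : 0 = m
    · subst e0; simp [h0, n1, n2]
    by_cases e1 : Finsupp.single 0 1 = m
    · subst e1; simp [h0, e0, n3.symm]
    by_cases e2 : Finsupp.single 1 1 = m
    · subst e2; simp [h0, e0, e1]
    simp [e0, e1, e2]

theorem exists_curl_eq {p : Fin 2 → Poly2} (hp : ∀ c, (p c).totalDegree ≤ 1) (hd : div p = 0) :
    ∃ q : Poly2, q.totalDegree ≤ 2 ∧ q.curl = p := by
  obtain ⟨r, s, t, h0⟩ := eq_affine_of_totalDegree_le_one (hp 0)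
  obtain ⟨r', s', t', h1⟩ := eq_affine_of_totalDegree_le_one (hp 1)
  have hst : t' = -s := by
    simp only [div, h0, h1, map_add, pderiv_mul, pderiv_C, pderiv_X] at hd
    have := congrArg (MvPolynomial.coeff 0) hd
    simp at this
    linarith
  -- The stream function, integrated term by term; the mixed term serves both components because `t'
  -- = -s`.
  refine ⟨C r * X 1 - C r' * X 0 + C s * (X 0 * X 1) + C (t / 2) * (X 1 * X 1) -
    C (s' / 2) * (X 0 * X 0), ?_, ?_⟩
  · have hX : ∀ (u : ℝ) (i : Fin 2), (C u * X i : Poly2).totalDegree ≤ 2 := fun u i =>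
      (totalDegree_mul _ _).trans (by simp)
    have hXX : ∀ (u : ℝ) (i j : Fin 2), (C u * (X i * X j) : Poly2).totalDegree ≤ 2 := fun u i j =>
      (totalDegree_mul _ _).trans (by
        rw [totalDegree_C, zero_add]
        exact (totalDegree_mul _ _).trans (by simp))
    have hadd : ∀ {f g : Poly2}, f.totalDegree ≤ 2 → g.totalDegree ≤ 2 →
        (f + g).totalDegree ≤ 2 := fun hf hg => (totalDegree_add _ _).trans (max_le hf hg)
    have hsub : ∀ {f g : Poly2}, f.totalDegree ≤ 2 → g.totalDegree ≤ 2 →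
        (f - g).totalDegree ≤ 2 := fun hf hg => (totalDegree_sub _ _).trans (max_le hf hg)
    exact hsub (hadd (hadd (hsub (hX _ _) (hX _ _)) (hXX _ _ _)) (hXX _ _ _)) (hXX _ _ _)
  · have hhalf : ∀ u : ℝ, (C u : Poly2) = C (u / 2) + C (u / 2) := fun u => by
      rw [← C_add, add_halves]
    funext c
    fin_cases c
    · simp only [Fin.zero_eta, h0, curl, Matrix.cons_val_zero, map_add, map_sub, pderiv_mul,
        pderiv_C, pderiv_X]
      rw [hhalf t]
      simp
      ring
    · simp only [Fin.mk_one, h1, curl, Matrix.cons_val_one, map_add, map_sub, pderiv_mul,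
        pderiv_C, pderiv_X, hst]
      rw [hhalf s']
      simp
      ring

/-- An open set contains a box with infinite sides, and a polynomial is determined by its values on
such a box. -/
theorem eq_of_eqOn_open {p q : Poly2} {U : Set Plane} (hU : IsOpen U) (hne : U.Nonempty)
    (h : EqOn p.evalAt q.evalAt U) : p = q := by
  obtain ⟨x, hx⟩ := hne
  have hV : IsOpen ((WithLp.toLp 2 : (Fin 2 → ℝ) → Plane) ⁻¹' U) :=
    hU.preimage (PiLp.continuous_toLp 2 _)
  obtain ⟨u, hu, hsub⟩ := isOpen_pi_iff'.1 hV (fun c => x c) hx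
  refine funext_set u (fun c => infinite_of_mem_nhds _ ((hu c).1.mem_nhds (hu c).2)) fun y hy => ?_
  exact h (hsub hy)

end Poly2

/-! ### Piecewise polynomials as elements of `L²` -/

theorem volume_segment_eq_zero {a b : Plane} (hab : a ≠ b) : volume (segment ℝ a b) = 0 := by
  refine measure_mono_null (fun x hx => ?_) (Convex.addHaar_frontier volume (convex_segment a b))
  have hline : ∀ y ∈ segment ℝ a b, cross (b - a) (y - a) = 0 := by
    intro y hy
    rw [segment_eq_image_lineMap] at hy
    obtain ⟨t, -, rfl⟩ := hy
    rw [cross_lineMap]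
    simp only [cross, sub_self, PiLp.zero_apply]; ring
  refine ⟨subset_closure hx, fun hint => ?_⟩
  obtain ⟨z, hz, hz'⟩ := ((frequently_cross_pos hab (hline x hx)).and_eventually
    (mem_interior_iff_mem_nhds.1 hint)).exists
  exact hz.ne' (hline z hz')

theorem ConvexQuad.IsEdge.ne {Q : ConvexQuad} {a b : Plane} (h : Q.IsEdge a b) : a ≠ b := by
  obtain ⟨k, ⟨rfl, rfl⟩ | ⟨rfl, rfl⟩⟩ := h
  · exact Q.vertex_ne_vertex_add_one k
  · exact (Q.vertex_ne_vertex_add_one k).symm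

namespace QuadMesh

variable {Ω : Set Plane} {ι : Type*} (G : QuadMesh Ω ι)

theorem carrier_subset_closure (i : ι) : (G.cell i).carrier ⊆ closure Ω :=
  G.cover ▸ subset_iUnion (fun i => (G.cell i).carrier) i

variable {G}

/-- Each cell interior meets `Ω` in a nonempty open set, where continuous functions equal almost
everywhere are equal. This identifies the polynomial families chosen separately in the definitions
of the spaces. -/
theorem IsPiecewise.unique (hΩ : IsOpen Ω) {v : L2 Ω} {p q : ι → Poly2} (hp : G.IsPiecewise v p)
    (hq : G.IsPiecewise v q) : p = q := by
  funext i
  have hne : (interior (G.cell i).carrier ∩ Ω).Nonempty := by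
    obtain ⟨x, hx⟩ := (G.cell i).interior_carrier_nonempty
    exact mem_closure_iff.1 (G.carrier_subset_closure i (interior_subset hx)) _ isOpen_interior hx
  have hO : IsOpen (interior (G.cell i).carrier ∩ Ω) := isOpen_interior.inter hΩ
  refine Poly2.eq_of_eqOn_open hO hne (Measure.eqOn_open_of_ae_eq (μ := volume) ?_ hO
    (Poly2.continuous_evalAt _).continuousOn (Poly2.continuous_evalAt _).continuousOn)
  have h1 := ae_restrict_of_ae_restrict_of_subset inter_subset_right (hp i)
    (s := interior (G.cell i).carrier ∩ Ω)
  have h2 := ae_restrict_of_ae_restrict_of_subset inter_subset_right (hq i)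
    (s := interior (G.cell i).carrier ∩ Ω)
  filter_upwards [h1, h2, ae_restrict_mem hO.measurableSet] with x hx1 hx2 hx
  rw [← hx1 (interior_subset hx.1), ← hx2 (interior_subset hx.1)]

theorem volume_inter_eq_zero (G : QuadMesh Ω ι) {i j : ι} (hij : i ≠ j) :
    volume ((G.cell i).carrier ∩ (G.cell j).carrier) = 0 := by
  rcases G.conforming i j hij with h | ⟨a, -, -, h⟩ | ⟨a, b, hab, -, h⟩
  · rw [h, measure_empty]
  · rw [h]; exact measure_singleton a
  · rw [h]; exact volume_segment_eq_zero hab.ne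

/-- Every family of polynomials on the cells comes from a square integrable function. -/
theorem exists_isPiecewise [Finite ι] (G : QuadMesh Ω ι) (p : ι → Poly2) :
    ∃ v : L2 Ω, G.IsPiecewise v p := by
  cases nonempty_fintype ι
  let f : ι → Plane → ℝ := fun i => (G.cell i).carrier.indicator (p i).evalAt
  have hmeas : ∀ i, Measurable (f i) := fun i =>
    (Poly2.continuous_evalAt _).measurable.indicator (G.cell i).isClosed_carrier.measurableSet
  have hf : ∀ i, MemLp (f i) 2 (volume.restrict Ω) := by
    intro i
    refine (memLp_indicator_iff_restrict (G.cell i).isClosed_carrier.measurableSet).2 ?_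
    obtain ⟨C, hC⟩ := (G.cell i).isCompact_carrier.exists_bound_of_continuousOn
      (Poly2.continuous_evalAt (p i)).continuousOn
    have : IsFiniteMeasure ((volume.restrict Ω).restrict (G.cell i).carrier) := by
      refine ⟨?_⟩
      rw [Measure.restrict_apply_univ]
      exact (Measure.restrict_apply_le _ _).trans_lt (G.cell i).isCompact_carrier.measure_lt_top
    refine MemLp.of_bound (Poly2.continuous_evalAt _).aestronglyMeasurable C ?_
    exact (ae_restrict_mem (G.cell i).isClosed_carrier.measurableSet).mono hC
  have hF : MemLp (fun x => ∑ i, f i x) 2 (volume.restrict Ω) :=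
    memLp_finsetSum _ fun i _ => hf i
  refine ⟨hF.toLp, fun i => ?_⟩
  -- Overlaps of cells are null, so almost everywhere on a cell only its own summand survives.
  have hnull : ∀ᵐ x ∂(volume.restrict Ω), ∀ j, j ≠ i →
      x ∉ (G.cell i).carrier ∩ (G.cell j).carrier := by
    rw [ae_all_iff]
    intro j
    by_cases hj : j = i
    · simp [hj]
    · have := measure_eq_zero_iff_ae_notMem.1 (G.volume_inter_eq_zero (Ne.symm hj))
      exact (ae_restrict_of_ae this).mono fun x hx _ => hx
  filter_upwards [hF.coeFn_toLp, hnull] with x hx hx' hxi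
  rw [hx, Finset.sum_eq_single i]
  · exact indicator_of_mem hxi _
  · intro j _ hj
    exact indicator_of_notMem (fun hxj => hx' j hj ⟨hxi, hxj⟩) _
  · intro h; exact absurd (Finset.mem_univ i) h

end QuadMesh

/-! ### Boundary of the domain and edges of the mesh -/

/-- A Lipschitz domain lies on one side of its boundary. -/
theorem IsLipschitzDomain.interior_closure_subset {Ω : Set Plane} (hΩ : IsLipschitzDomain Ω) :
    interior (closure Ω) ⊆ Ω := by
  intro x hx
  by_contra hxΩ
  obtain ⟨T, K, f, U, hf, hU, hxU, hΩU⟩ := hΩ.boundary x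
    ⟨interior_subset hx, fun h => hxΩ (interior_subset h)⟩
  have hxf : T x 1 ≤ f (T x 0) := by
    by_contra! h
    exact hxΩ (hΩU.symm.subset ⟨h, hxU⟩).1
  -- Moving down from `x` leads strictly below the graph while staying in the closure of `Ω`; but
  -- near such a point there is nothing of `Ω`.
  let e : Plane := !₂[0, 1]
  have hlim : Tendsto (fun ε : ℝ => x - ε • T.symm e) (𝓝[>] 0) (𝓝 x) := by
    have : Tendsto (fun ε : ℝ => x - ε • T.symm e) (𝓝 0) (𝓝 (x - (0 : ℝ) • T.symm e)) :=
      (by fun_prop : Continuous fun ε : ℝ => x - ε • T.symm e).tendsto 0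
    simp only [zero_smul, sub_zero] at this
    exact this.mono_left nhdsWithin_le_nhds
  obtain ⟨ε, ⟨hεU, hεcl⟩, hε⟩ := ((hlim.eventually ((hU.eventually_mem hxU).and
    (isOpen_interior.eventually_mem hx))).and self_mem_nhdsWithin).exists
  have hε' : 0 < ε := hε
  have hTy : T (x - ε • T.symm e) = T x - ε • e := by simp
  have hN : IsOpen ({y | T y 1 < f (T y 0)} ∩ U) := by
    refine IsOpen.inter (isOpen_lt ?_ (hf.continuous.comp ?_)) hU
    · have := T.continuous; fun_prop
    · have := T.continuous; fun_prop
  obtain ⟨z, ⟨hz1, hzU⟩, hzΩ⟩ := mem_closure_iff.1 (interior_subset hεcl) _ hN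
    ⟨by
      change T (x - ε • T.symm e) 1 < f (T (x - ε • T.symm e) 0)
      rw [hTy]
      have h1 : (T x - ε • e) 1 = T x 1 - ε := by simp [e]
      have h0 : (T x - ε • e) 0 = T x 0 := by simp [e]
      rw [h1, h0]; linarith, hεU⟩
  have hz2 : f (T z 0) < T z 1 := (hΩU.subset ⟨hzΩ, hzU⟩).1
  have hz1' : T z 1 < f (T z 0) := hz1
  exact lt_asymm hz1' hz2

namespace QuadMesh

variable {Ω : Set Plane} {ι : Type*} (G : QuadMesh Ω ι)

theorem eventually_mem_carrier_imp [Finite ι] (x : Plane) :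
    ∀ᶠ z in 𝓝 x, ∀ i, z ∈ (G.cell i).carrier → x ∈ (G.cell i).carrier := by
  rw [eventually_all]
  intro i
  by_cases hx : x ∈ (G.cell i).carrier
  · simp [hx]
  · filter_upwards [(G.cell i).isClosed_carrier.isOpen_compl.mem_nhds hx] with z hz hzi
    exact absurd hzi hz

/-- A cell that contains a point of an open edge of another cell shares this edge. -/
theorem inter_eq_segment {i j : ι} (hij : i ≠ j) {k : Fin 4} {y : Plane}
    (hyj : y ∈ (G.cell j).carrier)
    (hy : y ∈ segment ℝ ((G.cell i).vertex k) ((G.cell i).vertex (k + 1)))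
    (h0 : y ≠ (G.cell i).vertex k) (h1 : y ≠ (G.cell i).vertex (k + 1)) :
    (G.cell j).IsEdge ((G.cell i).vertex k) ((G.cell i).vertex (k + 1)) ∧
      (G.cell i).carrier ∩ (G.cell j).carrier =
        segment ℝ ((G.cell i).vertex k) ((G.cell i).vertex (k + 1)) := by
  have hyi := (G.cell i).segment_subset_carrier k hy
  rcases G.conforming i j hij with h | ⟨a, ⟨m, rfl⟩, -, h⟩ | ⟨a, b, ⟨m, hm⟩, hj, h⟩
  · exact absurd (h.subset ⟨hyi, hyj⟩) (notMem_empty y)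
  · have hym : y = (G.cell i).vertex m := by
      have : y ∈ ({(G.cell i).vertex m} : Set Plane) := h ▸ ⟨hyi, hyj⟩
      exact this
    rcases (G.cell i).eq_of_vertex_mem_segment (hym ▸ hy) with rfl | rfl
    · exact absurd hym h0
    · exact absurd hym h1
  · have hys : y ∈ segment ℝ a b := h ▸ ⟨hyi, hyj⟩
    have hmk : m = k := by
      by_contra hne
      have hpos := (G.cell i).side_pos_of_mem_segment hne hy h0 h1
      refine hpos.ne' ((G.cell i).side_eq_zero_of_mem_segment ?_)
      rcases hm with ⟨rfl, rfl⟩ | ⟨rfl, rfl⟩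
      · exact hys
      · rwa [segment_symm]
    subst hmk
    rcases hm with ⟨rfl, rfl⟩ | ⟨rfl, rfl⟩
    · exact ⟨hj, h⟩
    · refine ⟨?_, by rw [h, segment_symm]⟩
      obtain ⟨l, hl⟩ := hj
      exact ⟨l, hl.symm⟩

/-- A boundary point in a cell is a vertex of this cell or lies on a boundary edge of it. -/
theorem exists_edge_of_mem_frontier [Finite ι] (hΩ : IsLipschitzDomain Ω) {i : ι} {y : Plane}
    (hyi : y ∈ (G.cell i).carrier) (hy : y ∈ frontier Ω) :
    ∃ k, y ∈ segment ℝ ((G.cell i).vertex k) ((G.cell i).vertex (k + 1)) ∧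
      (y = (G.cell i).vertex k ∨ y = (G.cell i).vertex (k + 1) ∨
        segment ℝ ((G.cell i).vertex k) ((G.cell i).vertex (k + 1)) ⊆ frontier Ω) := by
  have hyint : y ∉ interior (closure Ω) := fun h =>
    hy.2 (hΩ.isOpen.interior_eq.symm ▸ hΩ.interior_closure_subset h)
  obtain ⟨k, hk⟩ := (G.cell i).exists_mem_segment_of_notMem_interior hyi
    fun h => hyint (interior_mono (G.carrier_subset_closure i) h)
  refine ⟨k, hk, ?_⟩
  by_contra! hcon
  obtain ⟨h0, h1, hnot⟩ := hcon
  -- A second cell through `y` would share the edge, and the two would cover a neighbourhood of `y`.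
  have hy_only : ∀ j, j ≠ i → y ∉ (G.cell j).carrier := by
    intro j hj hyj
    obtain ⟨hje, hjs⟩ := G.inter_eq_segment hj.symm hyj hk h0 h1
    refine hyint (mem_interior_iff_mem_nhds.2 (mem_of_superset
      (ConvexQuad.union_mem_nhds_of_inter_eq ⟨k, Or.inl ⟨rfl, rfl⟩⟩ hje hjs hk h0 h1) ?_))
    exact union_subset (G.carrier_subset_closure i) (G.carrier_subset_closure j)
  -- If an inner point `z` of the edge were in `Ω`, points just across the edge would lie in another
  -- cell that contains `z`, hence the whole edge, hence `y`.
  have hopen : openSegment ℝ ((G.cell i).vertex k) ((G.cell i).vertex (k + 1)) ⊆ frontier Ω := by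
    intro z hz
    have hzs := openSegment_subset_segment _ _ _ hz
    have hne := (G.cell i).vertex_ne_vertex_add_one k
    have hz0 : z ≠ (G.cell i).vertex k := by
      rintro rfl; exact hne (left_mem_openSegment_iff.1 hz)
    have hz1 : z ≠ (G.cell i).vertex (k + 1) := by
      rintro rfl; exact hne (right_mem_openSegment_iff.1 hz)
    refine ⟨G.carrier_subset_closure i ((G.cell i).segment_subset_carrier k hzs), fun hzint => ?_⟩
    have hside : cross ((G.cell i).vertex k - (G.cell i).vertex (k + 1))
        (z - (G.cell i).vertex (k + 1)) = 0 := by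
      have := (G.cell i).side_eq_zero_of_mem_segment hzs
      simp only [ConvexQuad.side, cross, PiLp.sub_apply] at this ⊢
      linarith
    obtain ⟨z', hz', hzΩ, hzc⟩ := ((frequently_cross_pos hne.symm hside).and_eventually
      ((hΩ.isOpen.eventually_mem (interior_subset hzint)).and
        (G.eventually_mem_carrier_imp z))).exists
    have hz'i : z' ∉ (G.cell i).carrier := by
      intro h
      have := (G.cell i).mem_carrier_iff.1 h k
      simp only [ConvexQuad.side, cross, PiLp.sub_apply] at this hz'
      linarith
    obtain ⟨j, hj⟩ := mem_iUnion.1 (G.cover.symm ▸ subset_closure hzΩ)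
    have hji : j ≠ i := by rintro rfl; exact hz'i hj
    obtain ⟨-, hjs⟩ := G.inter_eq_segment hji.symm (hzc j hj) hzs hz0 hz1
    exact hy_only j hji (hjs.symm ▸ hk : y ∈ (G.cell i).carrier ∩ (G.cell j).carrier).2
  refine hnot ?_
  rw [← closure_openSegment]
  exact closure_minimal hopen isClosed_frontier

/-! ### Choice of the constants -/

/-- Vertex values whose differences along edges agree between neighbouring cells and vanish along
boundary edges can be shifted by a constant on each cell such that they become continuous and vanish
at the boundary. -/
theorem exists_vertex_potential [Finite ι] (hΩ : IsLipschitzDomain Ω) (hsc : IsSimplyConnected Ω)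
    (q : ι → Plane → ℝ)
    (hedge : ∀ a b i j, (G.cell i).IsEdge a b → (G.cell j).IsEdge a b →
      q i b - q i a = q j b - q j a)
    (hbd : ∀ a b i, G.IsBoundaryEdge a b → (G.cell i).IsEdge a b → q i b = q i a) :
    ∃ C : ι → ℝ,
      (∀ a i j, (G.cell i).IsVertex a → (G.cell j).IsVertex a → q i a + C i = q j a + C j) ∧
      ∀ a ∈ frontier Ω, ∀ i, (G.cell i).IsVertex a → q i a + C i = 0 := by
  classical
  choose g hgc hg using fun i =>
    (G.cell i).exists_interpolant fun k => q i ((G.cell i).vertex k)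
  have hg_edge : ∀ i a b, (G.cell i).IsEdge a b → ∀ t ∈ Icc (0 : ℝ) 1,
      g i (AffineMap.lineMap a b t) = (1 - t) * q i a + t * q i b := by
    rintro i a b ⟨k, ⟨rfl, rfl⟩ | ⟨rfl, rfl⟩⟩ t ht
    · exact hg i k t ht
    · rw [← AffineMap.lineMap_apply_one_sub, hg i k (1 - t) ⟨by linarith [ht.2], by linarith [ht.1]⟩]
      ring
  have hg_vertex : ∀ i a, (G.cell i).IsVertex a → g i a = q i a := by
    rintro i a ⟨k, rfl⟩
    simpa using hg i k 0 ⟨le_rfl, zero_le_one⟩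
  -- Passing from vertex values to interpolants makes increments agree at all common points of two
  -- cells.
  have hg_cells : ∀ i j x y, x ∈ (G.cell i).carrier → x ∈ (G.cell j).carrier →
      y ∈ (G.cell i).carrier → y ∈ (G.cell j).carrier → g i y - g i x = g j y - g j x := by
    intro i j x y hxi hxj hyi hyj
    by_cases hij : i = j
    · rw [hij]
    rcases G.conforming i j hij with h | ⟨a, -, -, h⟩ | ⟨a, b, hi, hj, h⟩
    · exact absurd (h.subset ⟨hyi, hyj⟩) (notMem_empty y)
    · have hx : x ∈ ({a} : Set Plane) := h ▸ ⟨hxi, hxj⟩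
      have hy : y ∈ ({a} : Set Plane) := h ▸ ⟨hyi, hyj⟩
      rw [mem_singleton_iff] at hx hy
      rw [hx, hy, sub_self, sub_self]
    · have hx : x ∈ segment ℝ a b := h ▸ ⟨hxi, hxj⟩
      have hy : y ∈ segment ℝ a b := h ▸ ⟨hyi, hyj⟩
      rw [segment_eq_image_lineMap] at hx hy
      obtain ⟨s, hs, rfl⟩ := hx
      obtain ⟨t, ht, rfl⟩ := hy
      rw [hg_edge i a b hi s hs, hg_edge i a b hi t ht, hg_edge j a b hj s hs,
        hg_edge j a b hj t ht]
      linear_combination (t - s) * hedge a b i j hi hj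
  have hg_frontier : ∀ i x, ∀ᶠ y in 𝓝 x, y ∈ frontier Ω → y ∈ (G.cell i).carrier →
      g i y = g i x := by
    intro i x
    have h1 : ∀ᶠ y in 𝓝 x, ∀ k, y ∈ segment ℝ ((G.cell i).vertex k) ((G.cell i).vertex (k + 1)) →
        x ∈ segment ℝ ((G.cell i).vertex k) ((G.cell i).vertex (k + 1)) := by
      rw [eventually_all]
      intro k
      by_cases hx : x ∈ segment ℝ ((G.cell i).vertex k) ((G.cell i).vertex (k + 1))
      · simp [hx]
      · have hcl : IsClosed (segment ℝ ((G.cell i).vertex k) ((G.cell i).vertex (k + 1))) := by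
          rw [segment_eq_image_lineMap]
          exact (isCompact_Icc.image AffineMap.lineMap_continuous).isClosed
        filter_upwards [hcl.isOpen_compl.mem_nhds hx] with z hz hz'
        exact absurd hz' hz
    have h2 : ∀ᶠ y in 𝓝 x, ∀ k, y = (G.cell i).vertex k → x = (G.cell i).vertex k := by
      rw [eventually_all]
      intro k
      by_cases hx : x = (G.cell i).vertex k
      · simp [hx]
      · filter_upwards [isOpen_ne.mem_nhds hx] with z hz hz'
        exact absurd hz' hz
    filter_upwards [h1, h2] with y hy1 hy2 hyf hyi
    obtain ⟨k, hk, h | h | h⟩ := G.exists_edge_of_mem_frontier hΩ hyi hyf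
    · rw [h, ← hy2 k h]
    · rw [h, ← hy2 (k + 1) h]
    · have hE : (G.cell i).IsEdge ((G.cell i).vertex k) ((G.cell i).vertex (k + 1)) :=
        ⟨k, Or.inl ⟨rfl, rfl⟩⟩
      have hq := hbd _ _ i ⟨⟨i, hE⟩, h⟩ hE
      have hx := hy1 k hk
      rw [segment_eq_image_lineMap] at hx hk
      obtain ⟨s, hs, rfl⟩ := hx
      obtain ⟨t, ht, rfl⟩ := hk
      rw [hg_edge i _ _ hE s hs, hg_edge i _ _ hE t ht, hq]
      ring
  have hcover : ∀ z ∈ Ω, ∃ i, z ∈ (G.cell i).carrier := fun z hz =>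
    mem_iUnion.1 (G.cover.symm ▸ subset_closure hz)
  -- `P x z` says that `z` is close enough to `x` for the increment from `x` to `z` to be
  -- independent of the cell and zero when `z` is outside `Ω`.
  let P : Plane → Plane → Prop := fun x z =>
    (∀ i, z ∈ (G.cell i).carrier → x ∈ (G.cell i).carrier) ∧ (z ∉ Ω → x ∉ Ω) ∧
      ∀ i, z ∈ (G.cell i).carrier → z ∉ Ω → g i z = g i x
  have hP : ∀ x, ∀ᶠ z in 𝓝 x, P x z := by
    intro x
    have h2 : ∀ᶠ z in 𝓝 x, z ∉ Ω → x ∉ Ω := by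
      by_cases hx : x ∈ Ω
      · filter_upwards [hΩ.isOpen.mem_nhds hx] with z hz hz'
        exact absurd hz hz'
      · simp [hx]
    filter_upwards [G.eventually_mem_carrier_imp x, h2,
      eventually_all.2 fun i => hg_frontier i x] with z hz1 hz2 hz3
    refine ⟨hz1, hz2, fun i hzi hzΩ => hz3 i ?_ hzi⟩
    exact ⟨G.carrier_subset_closure i hzi, fun h => hzΩ (interior_subset h)⟩
  let φ : Plane → Plane → ℝ := fun x z =>
    if h : z ∈ Ω then g (hcover z h).choose z - g (hcover z h).choose x else 0
  have hφ_out : ∀ x z, z ∉ Ω → φ x z = 0 := fun x z hz => dif_neg hz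
  have hφ_cell : ∀ x z i, P x z → z ∈ (G.cell i).carrier → φ x z = g i z - g i x := by
    intro x z i hxz hzi
    by_cases hz : z ∈ Ω
    · simp only [φ, dif_pos hz]
      have hj := (hcover z hz).choose_spec
      exact hg_cells _ _ _ _ (hxz.1 _ hj) (hxz.1 _ hzi) hj hzi
    · rw [hφ_out x z hz, hxz.2.2 i hzi hz, sub_self]
  have hφ_self : ∀ x, φ x x = 0 := by
    intro x
    by_cases hx : x ∈ Ω
    · simp [φ, dif_pos hx]
    · exact hφ_out x x hx
  have hPint : ∀ {x z}, z ∈ interior {z | P x z} → P x z := fun {x z} h =>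
    (interior_subset h : z ∈ {z | P x z})
  -- The gluing takes place on the whole plane, so the exterior is treated like one more cell.
  obtain ⟨f, hf⟩ := exists_glue_of_locally_constant_sub (fun x => interior {z | P x z}) φ
    (fun x => isOpen_interior) (fun x => mem_interior_iff_mem_nhds.2 (hP x)) (by
      intro x y z hx hy
      filter_upwards [isOpen_interior.mem_nhds hx, isOpen_interior.mem_nhds hy, hP z]
        with z' hx' hy' hz'
      by_cases hzΩ : z' ∈ Ω
      · obtain ⟨i, hi⟩ := hcover z' hzΩ
        have hzi := hz'.1 i hi
        rw [hφ_cell x z' i (hPint hx') hi, hφ_cell y z' i (hPint hy') hi,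
          hφ_cell x z i (hPint hx) hzi, hφ_cell y z i (hPint hy) hzi]
        ring
      · have hzΩ' := hz'.2.1 hzΩ
        rw [hφ_out x z' hzΩ, hφ_out y z' hzΩ, hφ_out x z hzΩ', hφ_out y z hzΩ'])
  have hf' : ∀ x, ∀ᶠ z in 𝓝 x, f z - φ x z = f x := by
    intro x
    have := hf x x (mem_interior_iff_mem_nhds.2 (hP x))
    rwa [hφ_self, sub_zero] at this
  have hf_cell : ∀ i, ∀ x ∈ (G.cell i).carrier, ∀ y ∈ (G.cell i).carrier,
      f x - g i x = f y - g i y := by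
    intro i x hx y hy
    refine (G.cell i).convex_carrier.isPreconnected.induction₂
      (fun x y => f x - g i x = f y - g i y) (fun z _ => ?_)
      (fun x y z _ _ _ h h' => h.trans h') (fun x y _ _ h => h.symm) hx hy
    filter_upwards [nhdsWithin_le_nhds (hf' z), nhdsWithin_le_nhds (hP z),
      self_mem_nhdsWithin] with z' h1 h2 h3
    rw [hφ_cell z z' i h2 h3] at h1
    linarith
  -- One constant serves the whole boundary because the complement is connected.
  have hf_out : ∀ x ∈ Ωᶜ, ∀ y ∈ Ωᶜ, f x = f y := by
    intro x hx y hy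
    refine (hsc.isPreconnected_compl hΩ.isOpen hΩ.isBounded).induction₂
      (fun x y => f x = f y) (fun z _ => ?_)
      (fun x y z _ _ _ h h' => h.trans h') (fun x y _ _ h => h.symm) hx hy
    filter_upwards [nhdsWithin_le_nhds (hf' z), self_mem_nhdsWithin] with z' h1 h3
    rw [hφ_out z z' h3, sub_zero] at h1
    exact h1.symm
  obtain ⟨d, hd⟩ : ∃ d, ∀ x ∈ Ωᶜ, f x = d := by
    rcases Ωᶜ.eq_empty_or_nonempty with h | ⟨x, hx⟩
    · exact ⟨0, by simp [h]⟩
    · exact ⟨f x, fun y hy => hf_out y hy x hx⟩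
  have key : ∀ i a, (G.cell i).IsVertex a → q i a +
      (f ((G.cell i).vertex 0) - g i ((G.cell i).vertex 0) - d) = f a - d := by
    intro i a ha
    rw [← hg_vertex i a ha]
    obtain ⟨k, rfl⟩ := ha
    have := hf_cell i _ ((G.cell i).vertex_mem_carrier 0) _ ((G.cell i).vertex_mem_carrier k)
    linarith
  refine ⟨fun i => f ((G.cell i).vertex 0) - g i ((G.cell i).vertex 0) - d, ?_, ?_⟩
  · intro a i j hi hj
    rw [key i a hi, key j a hj]
  · intro a ha i hi
    rw [key i a hi, hd a fun h => ha.2 (hΩ.isOpen.interior_eq.symm ▸ h), sub_self]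

end QuadMesh

/-! ### Transfer between curls and Morley data; the two inclusions -/

namespace ConvexQuad

variable {Q : ConvexQuad} {a b : Plane}

theorem IsEdge.isVertex_left (h : Q.IsEdge a b) : Q.IsVertex a := by
  obtain ⟨k, ⟨h, -⟩ | ⟨-, h⟩⟩ := h
  · exact ⟨k, h⟩
  · exact ⟨k + 1, h⟩

theorem IsEdge.isVertex_right (h : Q.IsEdge a b) : Q.IsVertex b := by
  obtain ⟨k, ⟨-, h⟩ | ⟨h, -⟩⟩ := h
  · exact ⟨k + 1, h⟩
  · exact ⟨k, h⟩

end ConvexQuad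

namespace Poly2

open MvPolynomial

theorem evalAt_add_C (p : Poly2) (r : ℝ) (x : Plane) : evalAt (p + C r) x = evalAt p x + r := by
  simp [evalAt]

theorem curl_add_C (p : Poly2) (r : ℝ) : curl (p + C r) = curl p := by
  simp [curl]

theorem edgeMean_curl_eq {p q : Poly2} {a b : Plane} (hab : a ≠ b)
    (hv : evalAt p b - evalAt p a = evalAt q b - evalAt q a)
    (hn : edgeIntegral (p.dirDeriv (edgeNormal a b)) a b =
      edgeIntegral (q.dirDeriv (edgeNormal a b)) a b) (c : Fin 2) :
    edgeMean (evalAt (p.curl c)) a b = edgeMean (evalAt (q.curl c)) a b := by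
  fin_cases c
  · exact edgeMean_pderiv_eq hab hv hn 1
  · change edgeMean (evalAt (-pderiv 0 p)) a b = edgeMean (evalAt (-pderiv 0 q)) a b
    rw [edgeMean_neg, edgeMean_neg, edgeMean_pderiv_eq hab hv hn 0]

theorem edgeMean_pderiv_eq_of_curl {p q : Poly2} {a b : Plane}
    (h : ∀ c, edgeMean (evalAt (p.curl c)) a b = edgeMean (evalAt (q.curl c)) a b) (c : Fin 2) :
    edgeMean (evalAt (pderiv c p)) a b = edgeMean (evalAt (pderiv c q)) a b := by
  fin_cases c
  · have h1 : edgeMean (evalAt (-pderiv 0 p)) a b = edgeMean (evalAt (-pderiv 0 q)) a b := h 1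
    rw [edgeMean_neg, edgeMean_neg] at h1
    exact neg_injective h1
  · exact h 0

theorem evalAt_sub_eq_of_curl {p q : Poly2} {a b : Plane}
    (h : ∀ c, edgeMean (evalAt (p.curl c)) a b = edgeMean (evalAt (q.curl c)) a b) :
    evalAt p b - evalAt p a = evalAt q b - evalAt q a := by
  rw [evalAt_sub_evalAt, evalAt_sub_evalAt, edgeMean_pderiv_eq_of_curl h 0,
    edgeMean_pderiv_eq_of_curl h 1]

theorem edgeIntegral_dirDeriv_eq_of_curl {p q : Poly2} {a b : Plane}
    (h : ∀ c, edgeMean (evalAt (p.curl c)) a b = edgeMean (evalAt (q.curl c)) a b) :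
    edgeIntegral (p.dirDeriv (edgeNormal a b)) a b =
      edgeIntegral (q.dirDeriv (edgeNormal a b)) a b := by
  rw [edgeIntegral_dirDeriv, edgeIntegral_dirDeriv, edgeMean_pderiv_eq_of_curl h 0,
    edgeMean_pderiv_eq_of_curl h 1]

theorem evalAt_zero (x : Plane) : evalAt 0 x = 0 := by simp [evalAt]

/-- Boundary conditions are read as equality with the data of the zero polynomial, so the comparison
lemmas for two cells also cover boundary edges. -/
theorem edgeMean_curl_zero (c : Fin 2) (a b : Plane) :
    edgeMean (evalAt ((0 : Poly2).curl c)) a b = 0 := by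
  have : (0 : Poly2).curl c = 0 := by fin_cases c <;> simp [curl]
  simp [this, edgeMean, evalAt_zero]

theorem edgeIntegral_dirDeriv_zero (a b : Plane) :
    edgeIntegral ((0 : Poly2).dirDeriv (edgeNormal a b)) a b = 0 := by
  simp [edgeIntegral, edgeMean, dirDeriv, evalAt_zero]

end Poly2

namespace QuadMesh

variable {Ω : Set Plane} {ι : Type*} {G : QuadMesh Ω ι}

theorem curlImage_RQM0_subset (hΩ : IsOpen Ω) : G.curlImage G.RQM0 ⊆ G.divFreePS0 := by
  rintro w ⟨v, ⟨⟨p, hp, hdeg, hvert, hnorm⟩, p₁, hp₁, hvert0, hnorm0⟩, p₂, hp₂, hw⟩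
  obtain rfl := hp.unique hΩ hp₁
  obtain rfl := hp.unique hΩ hp₂
  refine ⟨fun c => ⟨⟨fun i => (p i).curl c, hw c, fun i => Poly2.totalDegree_curl_le (hdeg i) c,
    fun a b hab i j hi hj => ?_⟩, fun i => (p i).curl c, hw c, fun a b hab i hi => ?_⟩,
    fun c i => (p i).curl c, hw, fun i => Poly2.div_curl (p i)⟩
  · refine Poly2.edgeMean_curl_eq hi.ne ?_ (hnorm a b hab i j hi hj) c
    rw [hvert a i j hi.isVertex_left hj.isVertex_left,
      hvert b i j hi.isVertex_right hj.isVertex_right]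
  · rw [← Poly2.edgeMean_curl_zero c a b]
    refine Poly2.edgeMean_curl_eq hi.ne ?_ ?_ c
    · rw [hvert0 a (hab.2 (left_mem_segment ℝ a b)) i hi.isVertex_left,
        hvert0 b (hab.2 (right_mem_segment ℝ a b)) i hi.isVertex_right]
      simp [Poly2.evalAt_zero]
    · rw [hnorm0 a b hab i hi, Poly2.edgeIntegral_dirDeriv_zero]

theorem divFreePS0_subset [Finite ι] (hΩ : IsLipschitzDomain Ω) (hsc : IsSimplyConnected Ω) :
    G.divFreePS0 ⊆ G.curlImage G.RQM0 := by
  rintro w ⟨hw, p, hp, hdiv⟩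
  have hdeg : ∀ c i, (p c i).totalDegree ≤ 1 := by
    intro c
    obtain ⟨⟨p', hp', hdeg, -⟩, -⟩ := hw c
    rwa [← hp'.unique hΩ.isOpen (hp c)]
  have hmean : ∀ c a b, G.IsInteriorEdge a b → ∀ i j, (G.cell i).IsEdge a b →
      (G.cell j).IsEdge a b → edgeMean (p c i).evalAt a b = edgeMean (p c j).evalAt a b := by
    intro c
    obtain ⟨⟨p', hp', -, hmean⟩, -⟩ := hw c
    rwa [← hp'.unique hΩ.isOpen (hp c)]
  have hmean0 : ∀ c a b, G.IsBoundaryEdge a b → ∀ i, (G.cell i).IsEdge a b →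
      edgeMean (p c i).evalAt a b = 0 := by
    intro c
    obtain ⟨-, p', hp', hmean0⟩ := hw c
    rwa [← hp'.unique hΩ.isOpen (hp c)]
  choose q hqdeg hq using fun i => Poly2.exists_curl_eq (fun c => hdeg c i) (hdiv i)
  have hqc : ∀ c i, (q i).curl c = p c i := fun c i => congrFun (hq i) c
  have hint : ∀ a b, G.IsInteriorEdge a b → ∀ i j, (G.cell i).IsEdge a b → (G.cell j).IsEdge a b →
      ∀ c, edgeMean ((q i).curl c).evalAt a b = edgeMean ((q j).curl c).evalAt a b := by
    intro a b hab i j hi hj c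
    rw [hqc, hqc]; exact hmean c a b hab i j hi hj
  have hbdry : ∀ a b, G.IsBoundaryEdge a b → ∀ i, (G.cell i).IsEdge a b →
      ∀ c, edgeMean ((q i).curl c).evalAt a b = edgeMean ((0 : Poly2).curl c).evalAt a b := by
    intro a b hab i hi c
    rw [hqc, hmean0 c a b hab i hi, Poly2.edgeMean_curl_zero]
  have hbd : ∀ a b i, G.IsBoundaryEdge a b → (G.cell i).IsEdge a b →
      (q i).evalAt b = (q i).evalAt a := by
    intro a b i hab hi
    have := Poly2.evalAt_sub_eq_of_curl (hbdry a b hab i hi)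
    simp only [Poly2.evalAt_zero] at this
    linarith
  obtain ⟨C, hC, hC0⟩ := G.exists_vertex_potential hΩ hsc (fun i => (q i).evalAt) (by
    intro a b i j hi hj
    -- Continuity of means is assumed only across interior edges; on boundary edges both differences
    -- vanish.
    by_cases hab : segment ℝ a b ⊆ frontier Ω
    · simp only [hbd a b i ⟨⟨i, hi⟩, hab⟩ hi, hbd a b j ⟨⟨i, hi⟩, hab⟩ hj, sub_self]
    · exact Poly2.evalAt_sub_eq_of_curl (hint a b ⟨⟨i, hi⟩, hab⟩ i j hi hj)) hbd
  obtain ⟨v, hv⟩ := G.exists_isPiecewise fun i => q i + MvPolynomial.C (C i)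
  refine ⟨v, ⟨⟨_, hv, fun i => ?_, fun a i j hi hj => ?_, fun a b hab i j hi hj => ?_⟩, _, hv,
    fun a ha i hi => ?_, fun a b hab i hi => ?_⟩, _, hv, fun c => ?_⟩
  · refine (MvPolynomial.totalDegree_add _ _).trans (max_le (hqdeg i) ?_)
    rw [MvPolynomial.totalDegree_C]; exact Nat.zero_le _
  · rw [Poly2.evalAt_add_C, Poly2.evalAt_add_C]
    exact hC a i j hi hj
  · refine Poly2.edgeIntegral_dirDeriv_eq_of_curl fun c => ?_
    rw [Poly2.curl_add_C, Poly2.curl_add_C]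
    exact hint a b hab i j hi hj c
  · rw [Poly2.evalAt_add_C]
    exact hC0 a ha i hi
  · rw [← Poly2.edgeIntegral_dirDeriv_zero a b]
    refine Poly2.edgeIntegral_dirDeriv_eq_of_curl fun c => ?_
    rw [Poly2.curl_add_C]
    exact hbdry a b hab i hi c
  · simp only [Poly2.curl_add_C, hqc]
    exact hp c

end QuadMesh

theorem mainTheorem4 {ι : Type*} [Finite ι] {Ω : Set Plane} (hΩ : IsLipschitzDomain Ω)
    (hsc : IsSimplyConnected Ω) (G : QuadMesh Ω ι) :
    G.curlImage G.RQM0 = G.divFreePS0 :=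
  (QuadMesh.curlImage_RQM0_subset hΩ.isOpen).antisymm (QuadMesh.divFreePS0_subset hΩ hsc)
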